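/- Let $\Lambda_N=\Lambda(\mathbb C^N)$, $N\ge 0$, be an exterior algebra of constants with odd generators ($\Lambda_0=\mathbb C$), and let $(M,\mathcal O_M)$ be a complex analytic supermanifold over $\Lambda_N$, i.e. a space with a sheaf of supercommutative $\Lambda_N$-algebras locally isomorphic to $\mathcal H_W\otimes\Lambda(\xi_1,\dots,\xi_q)\otimes\Lambda_N$ over open $W\subseteq\mathbb C^p$, $\mathcal H_W$ being the sheaf of holomorphic functions. Let $\mathcal T_M$ be the sheaf of superderivations of $\mathcal O_M$ over $\Lambda_N$. Let $\mathcal F$ be a locally free sheaf of ($\mathbb Z/2$-graded) $\mathcal O_M$-modules of finite rank, $\nabla$ a connection on $\mathcal F$ and $A$ an odd global section of $\Omega^1_M\otimes \mathcal End\,\mathcal F$ (the differential being odd, so that $i_X(A)$ has the parity of $X$) such that all connections of the pencil $\mathcal P=\{\nabla+\lambda A:\lambda\in\mathbb C\}$ are flat. Let $u\in\mathcal F(M)$ be a primitive section with respect to $\nabla$: $u$ is even, $\nabla u=0$, and every point has a neighbourhood $U$ on which $\mathcal F$ has a homogeneous basis $(f_a)$ of $\nabla$-flat sections and there is an even $B\in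 \mathrm{End}(\mathcal F|_U)$ with $\nabla B=A$ such that, writing $Bu=\sum_a b^a f_a$, the morphism $Bu=(b^a):U\to\widetilde F$ to the affine superspace $\widetilde F$ of flat sections (with linear coordinates dual to $(f_a)$) is a local isomorphism of supermanifolds. Then there is a unique even isomorphism of $\mathcal O_M$-modules $\beta^*:\mathcal F\to\mathcal T_M$ which, for all such $U,(f_a),B$, sends each $f_a$ to the pullback under $Bu$ of the constant vector field $f_a$ on $\widetilde F$, i.e. $\beta^*(f_a)(b^c)=\delta_a^c$. All connections of the transported pencil $\mathcal P^*=\beta^*(\mathcal P)=\{\beta^*\circ(\nabla+\lambda A)\circ(\beta^*)^{-1}\}$ on $\mathcal T_M$ are torsionless and flat. With $A^*=\beta^*\circ A\circ(\beta^*)^{-1}$, each of the multiplications $X\circ_c Y=c\,i_X(A^*)(Y)$, $c\in\mathbb C^*$, is an F-manifold structure on $M$: it is supercommutative and associative, and $$P_{X\circ Y}(Z,W)=X\circ P_Y(Z,W)+(-1)^{XY}\,Y\circ P_X(Z,W),\qquad P_X(Z,W)=[X,Z\circ W]-[X,Z]\circ W-(-1)^{XZ}Z\circ[X,W],$$ for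 homogeneous local vector fields $X,Y,Z,W$, where $(-1)^{XY}$ is the sign given by the parities. Moreover, $e=\beta^*(u)$ is an identity for one of these multiplications. -/

import Mathlib

open TopologicalSpace

universe u v w w'

namespace SuperGeom

/-- The Koszul sign `(-1)^{ij}` for parities `i`, `j`. -/
def sgn (i j : ZMod 2) : ℤ := if i = 1 ∧ j = 1 then -1 else 1

/-! ### Superspaces -/

/-- A sheaf `𝒪` of supercommutative algebras on the space `M` over the exterior algebra
`Λ_N = Λ(ℂ^N)` of constants, whose generators are odd; `N = 0` means "over `ℂ`". -/
structure SuperSheaf (N : ℕ) (M : Type u) [TopologicalSpace M] where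
  Sec : Opens M → Type v
  [ring : ∀ U, Ring (Sec U)]
  [algebra : ∀ U, Algebra ℂ (Sec U)]
  /-- `parity U 0` and `parity U 1` are the even and the odd functions on `U`. -/
  parity : ∀ U, ZMod 2 → Submodule ℂ (Sec U)
  isCompl_parity : ∀ U, IsCompl (parity U 0) (parity U 1)
  one_mem : ∀ U, (1 : Sec U) ∈ parity U 0
  mul_mem : ∀ {U i j} {f g : Sec U}, f ∈ parity U i → g ∈ parity U j → f * g ∈ parity U (i + j)
  supercomm : ∀ {U i j} {f g : Sec U}, f ∈ parity U i → g ∈ parity U j →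
    f * g = sgn i j • (g * f)
  res : ∀ {V U : Opens M}, V ≤ U → Sec U →ₐ[ℂ] Sec V
  res_self : ∀ {U} (f : Sec U), res (le_refl U) f = f
  res_res : ∀ {W V U} (hWV : W ≤ V) (hVU : V ≤ U) (f : Sec U),
    res hWV (res hVU f) = res (hWV.trans hVU) f
  res_parity : ∀ {V U i} (h : V ≤ U) {f : Sec U}, f ∈ parity U i → res h f ∈ parity V i
  /-- The structure map of constants. -/
  const : ∀ U, ExteriorAlgebra ℂ (Fin N → ℂ) →ₐ[ℂ] Sec U
  const_parity : ∀ U (t : Fin N → ℂ), const U (ExteriorAlgebra.ι ℂ t) ∈ parity U 1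
  res_const : ∀ {V U} (h : V ≤ U) (l : ExteriorAlgebra ℂ (Fin N → ℂ)),
    res h (const U l) = const V l
  gluing : ∀ {ι : Type u} (U : ι → Opens M) (s : ∀ i, Sec (U i)),
    (∀ i j, res (inf_le_left : U i ⊓ U j ≤ U i) (s i) = res inf_le_right (s j)) →
    ∃! t : Sec (⨆ i, U i), ∀ i, res (le_iSup U i) t = s i

attribute [instance] SuperSheaf.ring SuperSheaf.algebra

/-! ### Superdomains and charts -/

section Model

variable {p : ℕ} (q N : ℕ) (W : Opens (Fin p → ℂ))

/-- `Λ(ξ_1, …, ξ_q, θ_1, …, θ_N)`: odd coordinates `ξ` and odd constants `θ`. -/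
abbrev Grassmann : Type := ExteriorAlgebra ℂ (Fin q ⊕ Fin N → ℂ)

/-- The functions on the superdomain of dimension `p|q` over `W ⊆ ℂ^p`, with constants `Λ_N`:
the algebra `H(W) ⊗ Λ(ξ, θ)`, where `H(W)` is the algebra of holomorphic functions on `W`,
realized as an algebra of functions `W → Λ(ξ, θ)`. -/
def Model : Subalgebra ℂ (W → Grassmann q N) :=
  Algebra.adjoin ℂ
    ({f | ∃ h : (Fin p → ℂ) → ℂ, DifferentiableOn ℂ h (W : Set (Fin p → ℂ)) ∧
        f = fun x : W => algebraMap ℂ (Grassmann q N) (h x)} ∪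
      Set.range fun (l : Grassmann q N) (_ : W) => l)

variable {q N W}

/-- Homogeneous functions of parity `i` on a superdomain. -/
def Model.HasParity (i : ZMod 2) (f : Model q N W) : Prop :=
  ∀ x, f.1 x ∈ CliffordAlgebra.evenOdd (0 : QuadraticForm ℂ (Fin q ⊕ Fin N → ℂ)) i

variable (q N W)

/-- The `p` even coordinates `x_a` and the `q` odd coordinates `ξ_j` of a superdomain. -/
def Model.coord : Fin p ⊕ Fin q → Model q N W
  | .inl a => ⟨fun x => algebraMap ℂ _ (x.1 a), Algebra.subset_adjoin
      (Or.inl ⟨fun x => x a, (differentiable_apply a).differentiableOn, rfl⟩)⟩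
  | .inr j => ⟨fun _ => ExteriorAlgebra.ι ℂ (Pi.single (Sum.inl j) 1),
      Algebra.subset_adjoin (Or.inr ⟨_, rfl⟩)⟩

/-- The inclusion of the span of the `θ_k` into the span of the `ξ_j` and the `θ_k`. -/
def thetaIncl : (Fin N → ℂ) →ₗ[ℂ] (Fin q ⊕ Fin N → ℂ) where
  toFun t := Sum.elim 0 t
  map_add' s t := by ext (j | k) <;> simp
  map_smul' c t := by ext (j | k) <;> simp

/-- The constants on a superdomain. -/
def Model.const (l : ExteriorAlgebra ℂ (Fin N → ℂ)) : Model q N W :=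
  ⟨fun _ => ExteriorAlgebra.map (thetaIncl q N) l, Algebra.subset_adjoin (Or.inr ⟨_, rfl⟩)⟩

end Model

variable {N : ℕ} {M : Type u} [TopologicalSpace M]

/-- The open subset of the domain of `φ` which corresponds to the open subset `W` of `ℂ^p`. -/
def pullOpen {p : ℕ} (φ : OpenPartialHomeomorph M (Fin p → ℂ)) (W : Opens (Fin p → ℂ)) :
    Opens M :=
  ⟨φ.source ∩ φ ⁻¹' W, φ.isOpen_inter_preimage W.2⟩

theorem pullOpen_mono {p : ℕ} (φ : OpenPartialHomeomorph M (Fin p → ℂ))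
    {W' W : Opens (Fin p → ℂ)} (h : W' ≤ W) : pullOpen φ W' ≤ pullOpen φ W :=
  fun _ hx => ⟨hx.1, h hx.2⟩

/-- The image of `φ`. -/
def imageOpen {p : ℕ} (φ : OpenPartialHomeomorph M (Fin p → ℂ)) : Opens (Fin p → ℂ) :=
  ⟨φ.target, φ.open_target⟩

/-- An isomorphism, over `Λ_N`, of an open subspace of `(M, 𝒪)` with a superdomain of dimension
`p|q`: a homeomorphism `φ` of an open subset of `M` onto an open subset of `ℂ^p`, and an
isomorphism of sheaves of superalgebras above it. -/
structure SuperChart (𝒪 : SuperSheaf.{u, v} N M) (p q : ℕ) where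
  φ : OpenPartialHomeomorph M (Fin p → ℂ)
  iso : ∀ W : Opens (Fin p → ℂ), W ≤ imageOpen φ → 𝒪.Sec (pullOpen φ W) ≃ₐ[ℂ] Model q N W
  iso_res : ∀ {W' W : Opens (Fin p → ℂ)} (h : W' ≤ W) (hW : W ≤ imageOpen φ)
    (f : 𝒪.Sec (pullOpen φ W)) (x : W'),
    (iso W' (h.trans hW) (𝒪.res (pullOpen_mono φ h) f)).1 x = (iso W hW f).1 ⟨x.1, h x.2⟩
  iso_parity : ∀ {W : Opens (Fin p → ℂ)} (hW : W ≤ imageOpen φ) {i : ZMod 2}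
    {f : 𝒪.Sec (pullOpen φ W)}, f ∈ 𝒪.parity _ i → Model.HasParity i (iso W hW f)
  iso_const : ∀ {W : Opens (Fin p → ℂ)} (hW : W ≤ imageOpen φ)
    (l : ExteriorAlgebra ℂ (Fin N → ℂ)), iso W hW (𝒪.const _ l) = Model.const q N W l

namespace SuperChart

variable {𝒪 : SuperSheaf.{u, v} N M} {p q : ℕ} (χ : SuperChart 𝒪 p q)

/-- The domain of the chart. -/
def source : Opens M := pullOpen χ.φ (imageOpen χ.φ)

/-- The coordinate functions of the chart: the pullbacks of `x_a` and `ξ_j`. -/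
def coord (a : Fin p ⊕ Fin q) : 𝒪.Sec χ.source :=
  (χ.iso (imageOpen χ.φ) le_rfl).symm (Model.coord q N (imageOpen χ.φ) a)

end SuperChart

namespace SuperSheaf

variable (𝒪 : SuperSheaf.{u, v} N M)

/-- `(M, 𝒪)` is a complex analytic supermanifold of dimension `p|q` over `Λ_N`. -/
def IsSupermanifold (p q : ℕ) : Prop :=
  ∀ x : M, ∃ χ : SuperChart 𝒪 p q, x ∈ χ.source

variable {𝒪} in
/-- Functions `b` on `U`, of which `r` are even and `s` are odd, are the components of a morphism
from `U` to the affine superspace `ℂ^{r|s}` over `Λ_N`. It is a local isomorphism (étale) if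
every point of `U` has a neighbourhood which it maps isomorphically onto a subdomain, that is, if
near every point the `b a` are the coordinate functions of a chart. -/
def IsLocalIso {r s : ℕ} {U : Opens M} (b : Fin r ⊕ Fin s → 𝒪.Sec U) : Prop :=
  ∀ x ∈ U, ∃ (χ : SuperChart 𝒪 r s) (h : χ.source ≤ U),
    x ∈ χ.source ∧ ∀ a, χ.coord a = 𝒪.res h (b a)

/-! ### Vector fields -/

/-- Families of `ℂ`-linear operators on the functions on the open subsets of `U`. -/
abbrev Op (U : Opens M) : Type (max u v) :=
  ∀ V : {V : Opens M // V ≤ U}, 𝒪.Sec V.1 →ₗ[ℂ] 𝒪.Sec V.1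

/-- `X` is a derivation over `Λ_N`, homogeneous of parity `i`, of the restriction of `𝒪` to `U`. -/
structure IsDer {U : Opens M} (i : ZMod 2) (X : 𝒪.Op U) : Prop where
  res : ∀ {W V : Opens M} (hWV : W ≤ V) (hVU : V ≤ U) (f : 𝒪.Sec V),
    𝒪.res hWV (X ⟨V, hVU⟩ f) = X ⟨W, hWV.trans hVU⟩ (𝒪.res hWV f)
  parity : ∀ {V : Opens M} (hVU : V ≤ U) {j : ZMod 2} {f : 𝒪.Sec V},
    f ∈ 𝒪.parity V j → X ⟨V, hVU⟩ f ∈ 𝒪.parity V (i + j)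
  const : ∀ {V : Opens M} (hVU : V ≤ U) (l : ExteriorAlgebra ℂ (Fin N → ℂ)),
    X ⟨V, hVU⟩ (𝒪.const V l) = 0
  leibniz : ∀ {V : Opens M} (hVU : V ≤ U) {j : ZMod 2} {f : 𝒪.Sec V} (g : 𝒪.Sec V),
    f ∈ 𝒪.parity V j → X ⟨V, hVU⟩ (f * g) = X ⟨V, hVU⟩ f * g + sgn i j • (f * X ⟨V, hVU⟩ g)

/-- The derivations of parity `i`. -/
def der (i : ZMod 2) (U : Opens M) : AddSubgroup (𝒪.Op U) where
  carrier := {X | 𝒪.IsDer i X}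
  zero_mem' := ⟨by simp, by simp, by simp, by simp⟩
  add_mem' {X Y} hX hY := by
    refine ⟨?_, ?_, ?_, ?_⟩
    · intro W V h h' f
      simp [hX.res h h', hY.res h h']
    · intro V h j f hf
      exact add_mem (hX.parity h hf) (hY.parity h hf)
    · intro V h l
      simp [hX.const h, hY.const h]
    · intro V h j f g hf
      simp only [Pi.add_apply, LinearMap.add_apply, hX.leibniz h g hf, hY.leibniz h g hf,
        add_mul, mul_add, smul_add]
      abel
  neg_mem' {X} hX := by
    refine ⟨?_, ?_, ?_, ?_⟩
    · intro W V h h' f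
      simp [hX.res h h']
    · intro V h j f hf
      exact neg_mem (hX.parity h hf)
    · intro V h l
      simp [hX.const h]
    · intro V h j f g hf
      simp only [Pi.neg_apply, LinearMap.neg_apply, hX.leibniz h g hf, neg_mul, mul_neg, smul_neg]
      abel

/-- The homogeneous vector fields of parity `i` over `U`. -/
abbrev HVF (i : ZMod 2) (U : Opens M) : Type (max u v) := ↥(𝒪.der i U)

/-- The sections over `U` of the tangent sheaf `𝒯_M`: sums of an even and an odd derivation. -/
abbrev VF (U : Opens M) : Type (max u v) := ↥(𝒪.der 0 U ⊔ 𝒪.der 1 U)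

variable {𝒪}

/-- The derivative of a function along a vector field. -/
def VF.app {U : Opens M} (X : 𝒪.VF U) (f : 𝒪.Sec U) : 𝒪.Sec U := X.1 ⟨U, le_rfl⟩ f

theorem der_le (i : ZMod 2) (U : Opens M) : 𝒪.der i U ≤ 𝒪.der 0 U ⊔ 𝒪.der 1 U := by
  fin_cases i
  · exact le_sup_left
  · exact le_sup_right

/-- A homogeneous vector field, as a vector field. -/
def HVF.toVF {i : ZMod 2} {U : Opens M} (X : 𝒪.HVF i U) : 𝒪.VF U := ⟨X.1, der_le i U X.2⟩

/-- Multiplication of a family of operators by a function. -/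
def fmul {U : Opens M} (f : 𝒪.Sec U) (X : 𝒪.Op U) : 𝒪.Op U :=
  fun V => LinearMap.mulLeft ℂ (𝒪.res V.2 f) ∘ₗ X V

theorem sgn_add (i j k : ZMod 2) : sgn (i + j) k = sgn i k * sgn j k := by
  revert i j k; decide

theorem sgn_comm (i j : ZMod 2) : sgn i j = sgn j i := by
  revert i j; decide

theorem fmul_mem_der {i j : ZMod 2} {U : Opens M} {f : 𝒪.Sec U} (hf : f ∈ 𝒪.parity U j)
    {X : 𝒪.Op U} (hX : X ∈ 𝒪.der i U) : fmul f X ∈ 𝒪.der (j + i) U := by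
  have hX : 𝒪.IsDer i X := hX
  refine ⟨?_, ?_, ?_, ?_⟩
  · intro W V h h' g
    simp [fmul, hX.res h h', 𝒪.res_res]
  · intro V h k g hg
    rw [add_assoc]
    exact 𝒪.mul_mem (𝒪.res_parity h hf) (hX.parity h hg)
  · intro V h l
    simp [fmul, hX.const h]
  · intro V h k g g' hg
    have := 𝒪.supercomm (𝒪.res_parity h hf) hg
    simp only [fmul, LinearMap.comp_apply, LinearMap.mulLeft_apply, hX.leibniz h g' hg, mul_add,
      mul_smul_comm, ← mul_assoc, this, sgn_add, mul_smul, smul_mul_assoc]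
    rw [smul_comm]

theorem fmul_mem {U : Opens M} (f : 𝒪.Sec U) {X : 𝒪.Op U} (hX : X ∈ 𝒪.der 0 U ⊔ 𝒪.der 1 U) :
    fmul f X ∈ 𝒪.der 0 U ⊔ 𝒪.der 1 U := by
  obtain ⟨X0, h0, X1, h1, rfl⟩ := AddSubgroup.mem_sup.1 hX
  obtain ⟨f0, hf0, f1, hf1, rfl⟩ := Submodule.mem_sup.1
    ((𝒪.isCompl_parity U).sup_eq_top ▸ Submodule.mem_top : f ∈ 𝒪.parity U 0 ⊔ 𝒪.parity U 1)
  have : fmul (f0 + f1) (X0 + X1) = fmul f0 X0 + fmul f0 X1 + (fmul f1 X0 + fmul f1 X1) := by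
    funext ⟨V, h⟩
    ext g
    simp [fmul, add_mul, mul_add]
    abel
  rw [this]
  exact add_mem (add_mem (der_le _ _ (fmul_mem_der hf0 h0)) (der_le _ _ (fmul_mem_der hf0 h1)))
    (add_mem (der_le _ _ (fmul_mem_der hf1 h0)) (der_le _ _ (fmul_mem_der hf1 h1)))

noncomputable instance (U : Opens M) : Module (𝒪.Sec U) (𝒪.VF U) where
  smul f X := ⟨fmul f X.1, fmul_mem f X.2⟩
  one_smul X := by
    apply Subtype.ext; funext ⟨V, h⟩; ext g
    change 𝒪.res h 1 * X.1 ⟨V, h⟩ g = _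
    simp
  mul_smul f f' X := by
    apply Subtype.ext; funext ⟨V, h⟩; ext g
    change 𝒪.res h (f * f') * X.1 ⟨V, h⟩ g = 𝒪.res h f * (𝒪.res h f' * X.1 ⟨V, h⟩ g)
    simp [mul_assoc]
  smul_zero f := by
    apply Subtype.ext; funext ⟨V, h⟩; ext g
    change 𝒪.res h f * 0 = 0
    simp
  smul_add f X Y := by
    apply Subtype.ext; funext ⟨V, h⟩; ext g
    change 𝒪.res h f * (X.1 ⟨V, h⟩ g + Y.1 ⟨V, h⟩ g) = 𝒪.res h f * X.1 ⟨V, h⟩ g + 𝒪.res h f * Y.1 ⟨V, h⟩ g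
    simp [mul_add]
  add_smul f f' X := by
    apply Subtype.ext; funext ⟨V, h⟩; ext g
    change 𝒪.res h (f + f') * X.1 ⟨V, h⟩ g = 𝒪.res h f * X.1 ⟨V, h⟩ g + 𝒪.res h f' * X.1 ⟨V, h⟩ g
    simp [add_mul]
  zero_smul X := by
    apply Subtype.ext; funext ⟨V, h⟩; ext g
    change 𝒪.res h 0 * X.1 ⟨V, h⟩ g = 0
    simp

theorem res_mem_der {i : ZMod 2} {V U : Opens M} (h : V ≤ U) {X : 𝒪.Op U} (hX : X ∈ 𝒪.der i U) :
    (fun W => X ⟨W.1, W.2.trans h⟩ : 𝒪.Op V) ∈ 𝒪.der i V := by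
  have hX : 𝒪.IsDer i X := hX
  exact ⟨fun h1 h2 => hX.res h1 (h2.trans h), fun h2 => hX.parity (h2.trans h),
    fun h2 => hX.const (h2.trans h), fun h2 => hX.leibniz (h2.trans h)⟩

/-- Restriction of vector fields. -/
def VF.res {V U : Opens M} (h : V ≤ U) : 𝒪.VF U →+ 𝒪.VF V where
  toFun X := ⟨fun W => X.1 ⟨W.1, W.2.trans h⟩, by
    obtain ⟨X0, h0, X1, h1, e⟩ := AddSubgroup.mem_sup.1 X.2
    rw [← e]
    exact add_mem (der_le 0 V (res_mem_der h h0)) (der_le 1 V (res_mem_der h h1))⟩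
  map_zero' := rfl
  map_add' _ _ := rfl

/-- The Lie superbracket `[X, Y] = XY - (-1)^{ij} YX` of vector fields of parities `i` and `j`. -/
def lie {i j : ZMod 2} {U : Opens M} (X : 𝒪.HVF i U) (Y : 𝒪.HVF j U) : 𝒪.HVF (i + j) U :=
  ⟨fun V => X.1 V ∘ₗ Y.1 V - sgn i j • (Y.1 V ∘ₗ X.1 V), by
    have hX : 𝒪.IsDer i X.1 := X.2
    have hY : 𝒪.IsDer j Y.1 := Y.2
    refine ⟨?_, ?_, ?_, ?_⟩
    · intro W V h h' f
      simp [hX.res h h', hY.res h h']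
    · intro V h k f hf
      have h1 := hX.parity h (hY.parity h hf)
      have h2 := hY.parity h (hX.parity h hf)
      rw [← add_assoc] at h1 h2
      rw [add_comm j i] at h2
      exact sub_mem h1 (zsmul_mem h2 _)
    · intro V h l
      simp [hX.const h, hY.const h]
    · intro V h k f g hf
      simp only [LinearMap.sub_apply, LinearMap.smul_apply, LinearMap.comp_apply,
        hX.leibniz h g hf, hY.leibniz h g hf, map_add, map_zsmul,
        hX.leibniz h g (hY.parity h hf), hX.leibniz h (Y.1 ⟨V, h⟩ g) hf,
        hY.leibniz h g (hX.parity h hf), hY.leibniz h (X.1 ⟨V, h⟩ g) hf]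
      generalize X.1 ⟨V, h⟩ (Y.1 ⟨V, h⟩ f) = a1
      generalize Y.1 ⟨V, h⟩ (X.1 ⟨V, h⟩ f) = a2
      generalize X.1 ⟨V, h⟩ (Y.1 ⟨V, h⟩ g) = a3
      generalize Y.1 ⟨V, h⟩ (X.1 ⟨V, h⟩ g) = a4
      generalize X.1 ⟨V, h⟩ f = a5
      generalize Y.1 ⟨V, h⟩ f = a6
      generalize X.1 ⟨V, h⟩ g = a7
      generalize Y.1 ⟨V, h⟩ g = a8
      have key : ∀ i j k : ZMod 2, sgn i (j + k) = sgn i j * sgn i k ∧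
          sgn (i + j) k = sgn i k * sgn j k ∧ sgn i j = sgn j i ∧ sgn i j * sgn i j = 1 := by
        decide
      rw [(key i j k).1, (key j i k).1, (key i j k).2.1, (key j i k).2.2.1]
      have e := (key i j k).2.2.2
      simp only [smul_add, smul_sub, smul_smul, sub_mul, mul_sub, smul_mul_assoc, mul_smul_comm]
      rw [show sgn i j * (sgn i j * sgn j k) = sgn j k by rw [← mul_assoc, e, one_mul],
        mul_comm (sgn j k) (sgn i k),
        show sgn i k * sgn j k * sgn i j = sgn i j * (sgn i k * sgn j k) by ring]
      abel⟩

end SuperSheaf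

/-! ### Sheaves of modules -/

variable {𝒪 : SuperSheaf.{u, v} N M}

/-- A presheaf of `ℤ/2`-graded `𝒪`-modules. -/
structure SuperModule (𝒪 : SuperSheaf.{u, v} N M) where
  Sec : Opens M → Type w
  [addCommGroup : ∀ U, AddCommGroup (Sec U)]
  [module : ∀ U, Module (𝒪.Sec U) (Sec U)]
  parity : ∀ U, ZMod 2 → AddSubgroup (Sec U)
  isCompl_parity : ∀ U, IsCompl (parity U 0) (parity U 1)
  smul_mem : ∀ {U i j} {f : 𝒪.Sec U} {s : Sec U}, f ∈ 𝒪.parity U i → s ∈ parity U j →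
    f • s ∈ parity U (i + j)
  res : ∀ {V U : Opens M}, V ≤ U → Sec U →+ Sec V
  res_self : ∀ {U} (s : Sec U), res (le_refl U) s = s
  res_res : ∀ {W V U} (hWV : W ≤ V) (hVU : V ≤ U) (s : Sec U),
    res hWV (res hVU s) = res (hWV.trans hVU) s
  res_smul : ∀ {V U} (h : V ≤ U) (f : 𝒪.Sec U) (s : Sec U), res h (f • s) = 𝒪.res h f • res h s
  res_parity : ∀ {V U i} (h : V ≤ U) {s : Sec U}, s ∈ parity U i → res h s ∈ parity V i

attribute [instance] SuperModule.addCommGroup SuperModule.module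

namespace SuperModule

variable (F : SuperModule.{u, v, w} 𝒪)

/-- The sheaf condition. -/
def IsSheaf : Prop :=
  ∀ {ι : Type u} (U : ι → Opens M) (s : ∀ i, F.Sec (U i)),
    (∀ i j, F.res (inf_le_left : U i ⊓ U j ≤ U i) (s i) = F.res inf_le_right (s j)) →
    ∃! t : F.Sec (⨆ i, U i), ∀ i, F.res (le_iSup U i) t = s i

variable {F} in
/-- `e` is a basis over `U`, with `r` even and `s` odd members, of the `𝒪`-module `F`. -/
structure IsFrame {r s : ℕ} {U : Opens M} (e : Fin r ⊕ Fin s → F.Sec U) : Prop where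
  even : ∀ a, e (.inl a) ∈ F.parity U 0
  odd : ∀ a, e (.inr a) ∈ F.parity U 1
  basis : ∀ {V : Opens M} (h : V ≤ U) (t : F.Sec V),
    ∃! c : Fin r ⊕ Fin s → 𝒪.Sec V, t = ∑ a, c a • F.res h (e a)

/-- Locally free sheaves of finite rank. -/
structure IsLocallyFree : Prop where
  isSheaf : F.IsSheaf
  exists_frame : ∀ x : M, ∃ (U : Opens M) (r s : ℕ) (e : Fin r ⊕ Fin s → F.Sec U),
    x ∈ U ∧ IsFrame e

end SuperModule

/-- The tangent sheaf `𝒯_M`. -/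
noncomputable abbrev tangent (𝒪 : SuperSheaf.{u, v} N M) : SuperModule.{u, v, max u v} 𝒪 where
  Sec := 𝒪.VF
  parity U i := (𝒪.der i U).addSubgroupOf (𝒪.der 0 U ⊔ 𝒪.der 1 U)
  isCompl_parity U := by
    constructor
    · rw [AddSubgroup.disjoint_def]
      intro X h0 h1
      have h0 : 𝒪.IsDer 0 X.1 := h0
      have h1 : 𝒪.IsDer 1 X.1 := h1
      have key : ∀ V (h : V ≤ U) (j : ZMod 2) (f : 𝒪.Sec V), f ∈ 𝒪.parity V j →
          X.1 ⟨V, h⟩ f = 0 := by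
        intro V h j f hf
        have a0 := h0.parity h hf
        have a1 := h1.parity h hf
        have d := Submodule.disjoint_def.1 (𝒪.isCompl_parity V).disjoint
        fin_cases j
        · exact d _ a0 a1
        · exact d _ a1 a0
      apply Subtype.ext; funext ⟨V, h⟩; ext f
      obtain ⟨f0, hf0, f1, hf1, rfl⟩ := Submodule.mem_sup.1
        ((𝒪.isCompl_parity V).sup_eq_top ▸ Submodule.mem_top :
          f ∈ 𝒪.parity V 0 ⊔ 𝒪.parity V 1)
      rw [map_add, key V h 0 f0 hf0, key V h 1 f1 hf1]
      simp
    · rw [codisjoint_iff, eq_top_iff]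
      intro X _
      obtain ⟨X0, h0, X1, h1, e⟩ := AddSubgroup.mem_sup.1 X.2
      exact AddSubgroup.mem_sup.2 ⟨⟨X0, SuperSheaf.der_le 0 U h0⟩, h0,
        ⟨X1, SuperSheaf.der_le 1 U h1⟩, h1, Subtype.ext e⟩
  smul_mem hf hX := SuperSheaf.fmul_mem_der hf hX
  res := SuperSheaf.VF.res
  res_self _ := rfl
  res_res _ _ _ := rfl
  res_smul {V U} h f X := by
    apply Subtype.ext; funext ⟨W, hW⟩; ext g
    change 𝒪.res (hW.trans h) f * X.1 ⟨W, hW.trans h⟩ g = 𝒪.res hW (𝒪.res h f) * X.1 ⟨W, hW.trans h⟩ g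
    rw [𝒪.res_res]
  res_parity h _ hX := SuperSheaf.res_mem_der h hX

/-- An isomorphism (even) of sheaves of `𝒪`-modules. -/
structure ModIso (F : SuperModule.{u, v, w} 𝒪) (G : SuperModule.{u, v, w'} 𝒪) where
  equiv : ∀ U, F.Sec U ≃ₗ[𝒪.Sec U] G.Sec U
  equiv_res : ∀ {V U} (h : V ≤ U) (s : F.Sec U), G.res h (equiv U s) = equiv V (F.res h s)
  equiv_parity : ∀ {U i} {s : F.Sec U}, s ∈ F.parity U i → equiv U s ∈ G.parity U i

/-! ### Connections -/

/-- A connection on `F`, through its covariant derivatives `∇_X = i_X ∘ ∇`. -/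
structure Connection (F : SuperModule.{u, v, w} 𝒪) where
  cov : ∀ {U : Opens M}, 𝒪.VF U → F.Sec U → F.Sec U
  add_left : ∀ {U} (X Y : 𝒪.VF U) (s : F.Sec U), cov (X + Y) s = cov X s + cov Y s
  smul_left : ∀ {U} (f : 𝒪.Sec U) (X : 𝒪.VF U) (s : F.Sec U), cov (f • X) s = f • cov X s
  add_right : ∀ {U} (X : 𝒪.VF U) (s t : F.Sec U), cov X (s + t) = cov X s + cov X t
  leibniz : ∀ {U i j} (X : 𝒪.HVF i U) {f : 𝒪.Sec U} (s : F.Sec U), f ∈ 𝒪.parity U j →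
    cov X.toVF (f • s) = X.toVF.app f • s + sgn i j • f • cov X.toVF s
  parity : ∀ {U i j} (X : 𝒪.HVF i U) {s : F.Sec U}, s ∈ F.parity U j →
    cov X.toVF s ∈ F.parity U (i + j)
  res : ∀ {V U} (h : V ≤ U) (X : 𝒪.VF U) (s : F.Sec U),
    F.res h (cov X s) = cov (SuperSheaf.VF.res h X) (F.res h s)

/-- A global section `A` of `Ω¹ ⊗ End F` (odd, the differential being odd), through the
contractions `i_X(A)`. -/
structure EndForm (F : SuperModule.{u, v, w} 𝒪) where
  val : ∀ {U : Opens M}, 𝒪.VF U → F.Sec U → F.Sec U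
  add_left : ∀ {U} (X Y : 𝒪.VF U) (s : F.Sec U), val (X + Y) s = val X s + val Y s
  smul_left : ∀ {U} (f : 𝒪.Sec U) (X : 𝒪.VF U) (s : F.Sec U), val (f • X) s = f • val X s
  add_right : ∀ {U} (X : 𝒪.VF U) (s t : F.Sec U), val X (s + t) = val X s + val X t
  smul_right : ∀ {U i j} (X : 𝒪.HVF i U) {f : 𝒪.Sec U} (s : F.Sec U), f ∈ 𝒪.parity U j →
    val X.toVF (f • s) = sgn i j • f • val X.toVF s
  parity : ∀ {U i j} (X : 𝒪.HVF i U) {s : F.Sec U}, s ∈ F.parity U j →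
    val X.toVF s ∈ F.parity U (i + j)
  res : ∀ {V U} (h : V ≤ U) (X : 𝒪.VF U) (s : F.Sec U),
    F.res h (val X s) = val (SuperSheaf.VF.res h X) (F.res h s)

/-- A complex number, as a function on `U`. -/
def scalar (𝒪 : SuperSheaf.{u, v} N M) (U : Opens M) (c : ℂ) : 𝒪.Sec U :=
  algebraMap ℂ (𝒪.Sec U) c

theorem scalar_mem (U : Opens M) (c : ℂ) : scalar 𝒪 U c ∈ 𝒪.parity U 0 := by
  rw [scalar, Algebra.algebraMap_eq_smul_one]
  exact Submodule.smul_mem _ _ (𝒪.one_mem U)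

theorem scalar_comm (U : Opens M) (c : ℂ) (f : 𝒪.Sec U) :
    scalar 𝒪 U c * f = f * scalar 𝒪 U c :=
  Algebra.commutes c f

section Transport

variable {F : SuperModule.{u, v, w} 𝒪}

/-- The form `c A` for a complex number `c`. -/
def EndForm.scale (c : ℂ) (A : EndForm F) : EndForm F where
  val {U} X s := scalar 𝒪 U c • A.val X s
  add_left X Y s := by rw [A.add_left, smul_add]
  smul_left f X s := by rw [A.smul_left, smul_smul, smul_smul, scalar_comm]
  add_right X s t := by rw [A.add_right, smul_add]
  smul_right X f s hf := by
    rw [A.smul_right X s hf, smul_comm (scalar 𝒪 _ c) (sgn _ _), smul_smul, smul_smul,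
      scalar_comm]
  parity X s hs := by
    have := F.smul_mem (scalar_mem _ c) (A.parity X hs)
    rwa [zero_add] at this
  res h X s := by
    rw [F.res_smul, A.res]
    simp [scalar]

/-- The connection `∇ + A`. -/
def Connection.addForm (D : Connection F) (A : EndForm F) : Connection F where
  cov X s := D.cov X s + A.val X s
  add_left X Y s := by rw [D.add_left, A.add_left]; abel
  smul_left f X s := by rw [D.smul_left, A.smul_left, smul_add]
  add_right X s t := by rw [D.add_right, A.add_right]; abel
  leibniz X f s hf := by rw [D.leibniz X s hf, A.smul_right X s hf, smul_add, smul_add, add_assoc]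
  parity X s hs := add_mem (D.parity X hs) (A.parity X hs)
  res h X s := by rw [map_add, D.res, A.res]

/-- The member `∇ + c A`, `c ∈ ℂ`, of the pencil through `∇` with direction `A`. -/
def Connection.pencil (D : Connection F) (A : EndForm F) (c : ℂ) : Connection F :=
  D.addForm (A.scale c)

/-- Vanishing of the curvature: `[∇_X, ∇_Y] = ∇_{[X, Y]}`. -/
def Connection.IsFlat (D : Connection F) : Prop :=
  ∀ {U : Opens M} {i j : ZMod 2} (X : 𝒪.HVF i U) (Y : 𝒪.HVF j U) (s : F.Sec U),
    D.cov X.toVF (D.cov Y.toVF s) - sgn i j • D.cov Y.toVF (D.cov X.toVF s) =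
      D.cov (SuperSheaf.lie X Y).toVF s

/-- Vanishing of the torsion of a connection on the tangent sheaf. -/
def Connection.IsTorsionFree (D : Connection (tangent 𝒪)) : Prop :=
  ∀ {U : Opens M} {i j : ZMod 2} (X : 𝒪.HVF i U) (Y : 𝒪.HVF j U),
    D.cov X.toVF Y.toVF - sgn i j • D.cov Y.toVF X.toVF = (SuperSheaf.lie X Y).toVF

variable {G : SuperModule.{u, v, w'} 𝒪}

theorem ModIso.symm_res (β : ModIso F G) {V U : Opens M} (h : V ≤ U) (t : G.Sec U) :
    F.res h ((β.equiv U).symm t) = (β.equiv V).symm (G.res h t) := by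
  rw [LinearEquiv.eq_symm_apply, ← β.equiv_res, LinearEquiv.apply_symm_apply]

theorem ModIso.symm_parity (β : ModIso F G) {U : Opens M} {i : ZMod 2} {t : G.Sec U}
    (ht : t ∈ G.parity U i) : (β.equiv U).symm t ∈ F.parity U i := by
  obtain ⟨s0, h0, s1, h1, e⟩ := AddSubgroup.mem_sup.1
    ((F.isCompl_parity U).sup_eq_top ▸ AddSubgroup.mem_top _ :
      (β.equiv U).symm t ∈ F.parity U 0 ⊔ F.parity U 1)
  have e' : t = β.equiv U s0 + β.equiv U s1 := by
    rw [← map_add, e, LinearEquiv.apply_symm_apply]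
  have d : ∀ {x : G.Sec U}, x ∈ G.parity U 0 → x ∈ G.parity U 1 → x = 0 :=
    AddSubgroup.disjoint_def.1 (G.isCompl_parity U).disjoint
  have g0 := β.equiv_parity h0
  have g1 := β.equiv_parity h1
  fin_cases i
  · have : β.equiv U s1 = 0 := d (by
      have := sub_mem ht g0
      rwa [e', add_sub_cancel_left] at this) g1
    rw [← e, (β.equiv U).map_eq_zero_iff.1 this, add_zero]
    exact h0
  · have : β.equiv U s0 = 0 := d g0 (by
      have := sub_mem ht g1
      rwa [e', add_sub_cancel_right] at this)
    rw [← e, (β.equiv U).map_eq_zero_iff.1 this, zero_add]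
    exact h1

/-- The connection `β ∘ ∇ ∘ β⁻¹` on `G` obtained from a connection on `F` by an isomorphism. -/
def Connection.transport (D : Connection F) (β : ModIso F G) : Connection G where
  cov {U} X t := β.equiv U (D.cov X ((β.equiv U).symm t))
  add_left X Y s := by rw [D.add_left, map_add]
  smul_left f X s := by rw [D.smul_left, map_smul]
  add_right X s t := by rw [map_add, D.add_right, map_add]
  leibniz X f s hf := by
    rw [map_smul, D.leibniz X _ hf, map_add, map_zsmul, map_smul, map_smul,
      LinearEquiv.apply_symm_apply]
  parity X s hs := β.equiv_parity (D.parity X (β.symm_parity hs))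
  res h X s := by rw [β.equiv_res, D.res, β.symm_res]

/-- The form `β ∘ A ∘ β⁻¹`. -/
def EndForm.transport (A : EndForm F) (β : ModIso F G) : EndForm G where
  val {U} X t := β.equiv U (A.val X ((β.equiv U).symm t))
  add_left X Y s := by rw [A.add_left, map_add]
  smul_left f X s := by rw [A.smul_left, map_smul]
  add_right X s t := by rw [map_add, A.add_right, map_add]
  smul_right X f s hf := by rw [map_smul, A.smul_right X _ hf, map_zsmul, map_smul]
  parity X s hs := β.equiv_parity (A.parity X (β.symm_parity hs))
  res h X s := by rw [β.equiv_res, A.res, β.symm_res]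

end Transport

/-! ### F-manifold structures -/

namespace EndForm

/-- The product `X ∘ Y = i_X(A)(Y)` of homogeneous vector fields. -/
def mul (A : EndForm (tangent 𝒪)) {U : Opens M} {i j : ZMod 2} (X : 𝒪.HVF i U) (Y : 𝒪.HVF j U) :
    𝒪.HVF (i + j) U :=
  ⟨(A.val X.toVF Y.toVF).1, A.parity X (s := Y.toVF) Y.2⟩

/-- `P_X(Z, W) = [X, Z ∘ W] - [X, Z] ∘ W - (-1)^{XZ} Z ∘ [X, W]`. -/
def poissonDefect (A : EndForm (tangent 𝒪)) {U : Opens M} {i k l : ZMod 2} (X : 𝒪.HVF i U)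
    (Z : 𝒪.HVF k U) (W : 𝒪.HVF l U) : 𝒪.VF U :=
  (SuperSheaf.lie X (A.mul Z W)).toVF - A.val (SuperSheaf.lie X Z).toVF W.toVF -
    sgn i k • A.val Z.toVF (SuperSheaf.lie X W).toVF

/-- The multiplication `X ∘ Y = i_X(A)(Y)` is an F-manifold structure: it is supercommutative and
associative and satisfies `P_{X ∘ Y}(Z, W) = X ∘ P_Y(Z, W) + (-1)^{XY} Y ∘ P_X(Z, W)`. -/
structure IsFManifold (A : EndForm (tangent 𝒪)) : Prop where
  supercomm : ∀ {U : Opens M} {i j : ZMod 2} (X : 𝒪.HVF i U) (Y : 𝒪.HVF j U),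
    A.val X.toVF Y.toVF = sgn i j • A.val Y.toVF X.toVF
  assoc : ∀ {U : Opens M} (X Y Z : 𝒪.VF U), A.val (A.val X Y) Z = A.val X (A.val Y Z)
  hertlingManin : ∀ {U : Opens M} {i j k l : ZMod 2} (X : 𝒪.HVF i U) (Y : 𝒪.HVF j U)
    (Z : 𝒪.HVF k U) (W : 𝒪.HVF l U),
    A.poissonDefect (A.mul X Y) Z W =
      A.val X.toVF (A.poissonDefect Y Z W) + sgn i j • A.val Y.toVF (A.poissonDefect X Z W)

/-- The global vector field `e` is a (two-sided) identity of the multiplication. -/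
def IsIdentity (A : EndForm (tangent 𝒪)) (e : 𝒪.VF ⊤) : Prop :=
  ∀ {U : Opens M} (X : 𝒪.VF U),
    A.val (SuperSheaf.VF.res le_top e) X = X ∧ A.val X (SuperSheaf.VF.res le_top e) = X

end EndForm

/-! ### Primitive sections -/

section Primitive

variable {F : SuperModule.{u, v, w} 𝒪}

/-- The section `s` over `U` is `∇`-flat. -/
def Connection.IsFlatSection (D : Connection F) {U : Opens M} (s : F.Sec U) : Prop :=
  ∀ {V : Opens M} (h : V ≤ U) (X : 𝒪.VF V), D.cov X (F.res h s) = 0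

/-- An even section over `U` of `End F`. -/
structure LocalEnd (F : SuperModule.{u, v, w} 𝒪) (U : Opens M) where
  map : ∀ V : Opens M, V ≤ U → F.Sec V →ₗ[𝒪.Sec V] F.Sec V
  map_res : ∀ {W V : Opens M} (hWV : W ≤ V) (hVU : V ≤ U) (s : F.Sec V),
    F.res hWV (map V hVU s) = map W (hWV.trans hVU) (F.res hWV s)
  map_parity : ∀ {V : Opens M} (hVU : V ≤ U) {i : ZMod 2} {s : F.Sec V},
    s ∈ F.parity V i → map V hVU s ∈ F.parity V i

/-- Over `U`: a basis `frame` of flat sections (linear coordinates of the space of flat sections),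
an even section `B` of `End F` with `∇B = A`, and the components `b` of `B u` in the basis, which
are required to define a local isomorphism from `U` to the affine superspace of flat sections. -/
structure PrimitiveData (D : Connection F) (A : EndForm F) (u : F.Sec ⊤) (U : Opens M) where
  r : ℕ
  s : ℕ
  frame : Fin r ⊕ Fin s → F.Sec U
  isFrame : SuperModule.IsFrame frame
  flat : ∀ a, D.IsFlatSection (frame a)
  B : LocalEnd F U
  cov_B : ∀ {V : Opens M} (h : V ≤ U) (X : 𝒪.VF V) (t : F.Sec V),
    D.cov X (B.map V h t) - B.map V h (D.cov X t) = A.val X t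
  b : Fin r ⊕ Fin s → 𝒪.Sec U
  B_apply : B.map U le_rfl (F.res le_top u) = ∑ a, b a • frame a
  isLocalIso : SuperSheaf.IsLocalIso b

/-- `u` is a primitive section with respect to `∇`, in the pencil through `∇` with direction `A`:
it is even and flat, and locally `B u`, where `∇B = A`, is a local isomorphism to the affine
superspace of flat sections. -/
structure IsPrimitive (D : Connection F) (A : EndForm F) (u : F.Sec ⊤) : Prop where
  even : u ∈ F.parity ⊤ 0
  flat : D.IsFlatSection u
  exists_data : ∀ x : M, ∃ U : Opens M, x ∈ U ∧ Nonempty (PrimitiveData D A u U)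

/-- `β` is the isomorphism `β^* : F → 𝒯_M` defined by `u`: it sends a flat section `f` to the
pullback by the local isomorphism `B u` of the constant vector field `f` on the affine superspace
of flat sections. For a basis `(f_a)` of flat sections, the constant vector field `f_a` is the
partial derivative with respect to the `a`-th linear coordinate, so the condition reads
`β(f_a) b^c = δ_a^c`. -/
def IsBetaStar (D : Connection F) (A : EndForm F) (u : F.Sec ⊤) (β : ModIso F (tangent 𝒪)) :
    Prop :=
  ∀ {U : Opens M} (P : PrimitiveData D A u U) (a c : Fin P.r ⊕ Fin P.s),
    SuperSheaf.VF.app (β.equiv U (P.frame a)) (P.b c) = if a = c then 1 else 0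

end Primitive

end SuperGeom

/-! Write `A_X` for the operator `i_X(A)` on `F`. Since `∇u = 0` and `∇B = A`, one has `∇_X(Bu) =
A_X u`, and in a flat frame this reads `A_X u = Σ X(b^c) f_c` (`PrimitiveData.val_eq_sum`). So `X ↦
A_X u`, which is global and involves no choice of `B` or of frame, is the differential of each local
isomorphism `Bu`. The `b^c` being local coordinates, and vector fields having freely prescribed
values on coordinates (`SuperChart.existsUnique_vf`), this map is an isomorphism locally, hence
globally by gluing. Its inverse is `β^*`: the condition `β^*(f_a)(b^c) = δ_a^c` says exactly `A_{β^*
s} u = s` (`isBetaStar_iff`), which gives existence and uniqueness.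

The analytic input is that a derivation killing the coordinates is zero. By Hadamard's lemma a
holomorphic function is, near a point `y`, a constant plus `Σ (x_a - y_a) g_a`, so its derivative
vanishes at `y`; and `y` is arbitrary.

The rest is algebra of operators. The curvature of `∇ + λA` is quadratic in `λ`. Its top coefficient
says that the `A_X` supercommute (`op_mul_comm`); the linear one expresses `A_{[X,Y]}` through `∇`
and `A` (`op_lie`). As `β^{*-1} X = A_X u`, a vector field is determined by `A_X`, and every section
of `F` is some `A_Z u`. Applied to `u`, `op_lie` is vanishing of torsion. The operators `A_{X∘Y}`
and `A_X A_Y` agree on `u` and supercommute with all `A_Z`, so they are equal (`op_mul`): the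
product is supercommutative and associative because composition of the `A_X` is. Finally
`A_{P_X(Z,W)}` is the supercommutator of `A_X` with an operator independent of `X`
(`op_poissonDefect`), so the Hertling–Manin identity is the Leibniz rule for a supercommutator. The
identity field comes from `A_e u = u`. -/

namespace SuperGeom

/-! ### Holomorphic functions of several variables -/

section Holomorphic

open MeasureTheory Metric

variable {p : ℕ}

/-- Holomorphic dependence of an integral of a holomorphic function over a family of affine maps. -/
theorem differentiableAt_integral_comp_affine {h : (Fin p → ℂ) → ℂ} {W : Set (Fin p → ℂ)}
    (hW : IsOpen W) (hh : DifferentiableOn ℂ h W) {a b : ℝ} {k m : ℝ → ℂ} {γ : ℝ → Fin p → ℂ}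
    (hk : Continuous k) (hm : Continuous m) (hγ : Continuous γ) {x₀ : Fin p → ℂ}
    (hx₀ : ∀ t ∈ Set.uIcc a b, m t • x₀ + γ t ∈ W) :
    DifferentiableAt ℂ (fun x => ∫ t in a..b, k t * h (m t • x + γ t)) x₀ := by
  set K : Set (Fin p → ℂ) := (fun t => m t • x₀ + γ t) '' Set.uIcc a b with hK
  have hKc : IsCompact K := isCompact_uIcc.image (by fun_prop)
  -- A compact thickening of the path inside `W` gives a uniform bound for `h` and uniform room for
  -- Cauchy estimates.
  obtain ⟨δ, hδ, hδW⟩ := hKc.exists_cthickening_subset_open hW (by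
    rintro _ ⟨t, ht, rfl⟩; exact hx₀ t ht)
  have hcomp : IsCompact (cthickening δ K) := hKc.cthickening
  obtain ⟨C, hC⟩ := hcomp.exists_bound_of_continuousOn (hh.continuousOn.mono hδW)
  obtain ⟨m₀, hm₀⟩ := (isCompact_uIcc (a := a) (b := b)).exists_bound_of_continuousOn
    hm.continuousOn
  obtain ⟨k₀, hk₀⟩ := (isCompact_uIcc (a := a) (b := b)).exists_bound_of_continuousOn
    hk.continuousOn
  have hm₀' : 0 ≤ m₀ := (norm_nonneg _).trans (hm₀ a Set.left_mem_uIcc)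
  have hk₀' : 0 ≤ k₀ := (norm_nonneg _).trans (hk₀ a Set.left_mem_uIcc)
  -- Moving `x₀` by less than `ρ` moves the path by less than `δ / 2`, which leaves balls of radius
  -- `δ / 2` inside the thickening; the `+ 1` avoids division by zero.
  set ρ := δ / 2 / (m₀ + 1) with hρ
  have hρ0 : 0 < ρ := by positivity
  have hnear : ∀ x ∈ ball x₀ ρ, ∀ t ∈ Set.uIcc a b,
      dist (m t • x + γ t) (m t • x₀ + γ t) < δ / 2 := by
    intro x hx t ht
    rw [dist_add_right, dist_eq_norm, ← smul_sub, norm_smul, ← dist_eq_norm]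
    calc ‖m t‖ * dist x x₀ ≤ (m₀ + 1) * dist x x₀ := by
          gcongr; exact (hm₀ t ht).trans (by linarith)
      _ < (m₀ + 1) * ρ := by
          gcongr; exact hx
      _ = δ / 2 := by rw [hρ]; field_simp
  have hball : ∀ x ∈ ball x₀ ρ, ∀ t ∈ Set.uIcc a b,
      ball (m t • x + γ t) (δ / 2) ⊆ cthickening δ K := by
    intro x hx t ht y hy
    refine mem_cthickening_of_dist_le y (m t • x₀ + γ t) δ K ⟨t, ht, rfl⟩ ?_
    have h1 := hnear x hx t ht
    have h2 : dist y (m t • x + γ t) < δ / 2 := hy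
    linarith [dist_triangle y (m t • x + γ t) (m t • x₀ + γ t)]
  have hmemW : ∀ x ∈ ball x₀ ρ, ∀ t ∈ Set.uIcc a b, m t • x + γ t ∈ W := fun x hx t ht =>
    hδW (hball x hx t ht (mem_ball_self (by positivity)))
  have hbound : ∀ x ∈ ball x₀ ρ, ∀ t ∈ Set.uIcc a b,
      ‖fderiv ℂ h (m t • x + γ t)‖ ≤ (C + C) / (δ / 2) := by
    intro x hx t ht
    -- Cauchy estimate: on the ball of radius `δ / 2`, `h` differs from its value at the centre by
    -- at most `C + C`.
    refine Complex.norm_fderiv_le_div_of_mapsTo_ball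
      (hh.mono ((hball x hx t ht).trans hδW)) ?_ (by positivity)
    intro y hy
    rw [mem_closedBall, dist_eq_norm]
    exact (norm_sub_le _ _).trans (add_le_add (hC y (hball x hx t ht hy))
      (hC _ (hball x hx t ht (mem_ball_self (by positivity)))))
  have hcont : ∀ x ∈ ball x₀ ρ,
      ContinuousOn (fun t => k t * h (m t • x + γ t)) (Set.uIcc a b) := fun x hx =>
    hk.continuousOn.mul (hh.continuousOn.comp (by fun_prop) (fun t ht => hmemW x hx t ht))
  have hsub : Set.uIoc a b ⊆ Set.uIcc a b := Set.uIoc_subset_uIcc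
  refine (intervalIntegral.hasFDerivAt_integral_of_dominated_of_fderiv_le (𝕜 := ℂ)
    (F' := fun x t => (k t * m t) • fderiv ℂ h (m t • x + γ t))
    (bound := fun _ => k₀ * m₀ * ((C + C) / (δ / 2)))
    (ball_mem_nhds x₀ hρ0) ?_ ?_ ?_ ?_ ?_ ?_).differentiableAt
  · filter_upwards [ball_mem_nhds x₀ hρ0] with x hx
    exact ((hcont x hx).mono hsub).aestronglyMeasurable measurableSet_uIoc
  · exact (hcont x₀ (mem_ball_self hρ0)).intervalIntegrable
  · refine Measurable.aestronglyMeasurable ?_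
    -- Measurability of the derivative suffices; its continuity is not known at this stage.
    exact ((hk.mul hm).measurable).smul ((measurable_fderiv ℂ h).comp (by fun_prop))
  · refine .of_forall fun t ht x hx => ?_
    rw [norm_smul, norm_mul]
    gcongr
    · exact hk₀ t (hsub ht)
    · exact hm₀ t (hsub ht)
    · exact hbound x hx t (hsub ht)
  · exact intervalIntegrable_const
  · refine .of_forall fun t ht x hx => ?_
    have h1 : HasFDerivAt h (fderiv ℂ h (m t • x + γ t)) (m t • x + γ t) :=
      (hh.differentiableAt (hW.mem_nhds (hmemW x hx t (hsub ht)))).hasFDerivAt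
    have h2 : HasFDerivAt (fun x : Fin p → ℂ => m t • x + γ t)
        (m t • ContinuousLinearMap.id ℂ (Fin p → ℂ)) x :=
      ((hasFDerivAt_id x).const_smul (m t)).add_const _
    have h3 := (h1.comp x h2).const_mul (k t)
    refine h3.congr_fderiv ?_
    ext v
    simp [mul_assoc]

theorem hasLineDerivAt_of_differentiableOn {h : (Fin p → ℂ) → ℂ} {W : Set (Fin p → ℂ)}
    (hW : IsOpen W) (hh : DifferentiableOn ℂ h W) {x : Fin p → ℂ} (hx : x ∈ W) (v : Fin p → ℂ) :
    HasLineDerivAt ℂ h (fderiv ℂ h x v) x v :=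
  (hh.differentiableAt (hW.mem_nhds hx)).hasFDerivAt.hasLineDerivAt v

/-- The directional derivatives of a holomorphic function are holomorphic. -/
theorem differentiableOn_fderiv_apply {h : (Fin p → ℂ) → ℂ} {W : Set (Fin p → ℂ)}
    (hW : IsOpen W) (hh : DifferentiableOn ℂ h W) (v : Fin p → ℂ) :
    DifferentiableOn ℂ (fun x => fderiv ℂ h x v) W := by
  intro x₀ hx₀
  refine DifferentiableAt.differentiableWithinAt ?_
  obtain ⟨ε, hε, hεW⟩ := Metric.isOpen_iff.1 hW x₀ hx₀
  -- Chosen so that `‖z • v‖ ≤ ε / 2` for `‖z‖ ≤ r`: the whole disc in direction `v` stays in `W`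
  -- for every `x` within `ε / 2` of `x₀`.
  set r : ℝ := ε / 2 / (‖v‖ + 1) with hr
  have hr0 : 0 < r := by positivity
  have hmem : ∀ x ∈ ball x₀ (ε / 2), ∀ z ∈ closedBall (0 : ℂ) r, x + z • v ∈ W := by
    intro x hx z hz
    apply hεW
    have h1 : dist x x₀ < ε / 2 := hx
    have h2 : ‖z‖ ≤ r := by simpa using hz
    have h3 : ‖z • v‖ ≤ ε / 2 := by
      rw [norm_smul]
      calc ‖z‖ * ‖v‖ ≤ r * (‖v‖ + 1) := by gcongr; linarith
        _ = ε / 2 := by rw [hr]; field_simp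
    have h4 : dist (x + z • v) x ≤ ε / 2 := by simpa [dist_eq_norm] using h3
    have h5 := dist_triangle (x + z • v) x x₀
    exact lt_of_le_of_lt h5 (by linarith)
  -- Cauchy's formula for the derivative of `z ↦ h (x + z v)` at `0`, written as an integral over a
  -- family of translations of `x`, to which `differentiableAt_integral_comp_affine` applies.
  have hcauchy : ∀ x ∈ ball x₀ (ε / 2), fderiv ℂ h x v = (2 * Real.pi * Complex.I)⁻¹ *
      ∫ t in (0 : ℝ)..2 * Real.pi, (deriv (circleMap 0 r) t * (1 / (circleMap 0 r t) ^ 2)) *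
        h ((1 : ℂ) • x + circleMap 0 r t • v) := by
    intro x hx
    have hd : DifferentiableOn ℂ (fun z : ℂ => h (x + z • v)) (closedBall 0 r) :=
      hh.comp (by fun_prop) (fun z hz => hmem x hx z hz)
    have e := hd.deriv_eq_smul_circleIntegral hr0
    have hl : deriv (fun z : ℂ => h (x + z • v)) 0 = fderiv ℂ h x v :=
      (hasLineDerivAt_of_differentiableOn hW hh (by
        simpa using hmem x hx 0 (by simp [hr0.le])) v).deriv
    rw [hl, circleIntegral] at e
    rw [eq_inv_mul_iff_mul_eq₀ Complex.two_pi_I_ne_zero, ← smul_eq_mul, ← e]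
    refine intervalIntegral.integral_congr fun t _ => ?_
    simp [mul_assoc]
  have hdiff : DifferentiableAt ℂ (fun x : Fin p → ℂ => (2 * Real.pi * Complex.I)⁻¹ *
      ∫ t in (0 : ℝ)..2 * Real.pi, (deriv (circleMap 0 r) t * (1 / (circleMap 0 r t) ^ 2)) *
        h ((1 : ℂ) • x + circleMap 0 r t • v)) x₀ := by
    refine DifferentiableAt.const_mul (differentiableAt_integral_comp_affine hW hh
      (m := fun _ => 1) ?_ continuous_const ?_ ?_) _
    · simp only [deriv_circleMap]
      have hc : Continuous (circleMap 0 r) := continuous_circleMap 0 r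
      refine (hc.mul continuous_const).mul (continuous_const.div (hc.pow 2) fun t => ?_)
      exact pow_ne_zero 2 (circleMap_ne_center hr0.ne')
    · exact (continuous_circleMap 0 r).smul continuous_const
    · intro t _
      rw [one_smul]
      exact hmem x₀ (mem_ball_self (by positivity)) _ (circleMap_mem_closedBall 0 hr0.le t)
  refine hdiff.congr_of_eventuallyEq ?_
  filter_upwards [ball_mem_nhds x₀ (half_pos hε)] with x hx using hcauchy x hx

/-- Hadamard's lemma. -/
theorem exists_eq_add_sum_sub_mul {h : (Fin p → ℂ) → ℂ} {y : Fin p → ℂ} {ε : ℝ}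
    (hh : DifferentiableOn ℂ h (ball y ε)) :
    ∃ g : Fin p → (Fin p → ℂ) → ℂ, (∀ a, DifferentiableOn ℂ (g a) (ball y ε)) ∧
      ∀ x ∈ ball y ε, h x = h y + ∑ a, (x a - y a) * g a x := by
  have hd := fun a : Fin p => differentiableOn_fderiv_apply isOpen_ball hh (Pi.single a 1)
  have hmem : ∀ x ∈ ball y ε, ∀ t ∈ Set.uIcc (0 : ℝ) 1,
      (t : ℂ) • x + (1 - (t : ℂ)) • y ∈ ball y ε := by
    intro x hx t ht
    rw [Set.uIcc_of_le zero_le_one] at ht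
    have e : (t : ℂ) • x + (1 - (t : ℂ)) • y - y = (t : ℂ) • (x - y) := by module
    rw [mem_ball, dist_eq_norm, e, norm_smul, ← dist_eq_norm, Complex.norm_real, Real.norm_eq_abs,
      abs_of_nonneg ht.1]
    exact lt_of_le_of_lt (mul_le_of_le_one_left dist_nonneg ht.2) hx
  -- The quotients are the averages of the partial derivatives over the segment from `y` to `x`; the
  -- identity is the fundamental theorem of calculus along that segment.
  refine ⟨fun a x => ∫ t in (0 : ℝ)..1, (1 : ℂ) *
    fderiv ℂ h ((t : ℂ) • x + (1 - (t : ℂ)) • y) (Pi.single a 1), fun a x hx => ?_, fun x hx => ?_⟩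
  · exact (differentiableAt_integral_comp_affine isOpen_ball (hd a) (k := fun _ => 1)
      (m := fun t => (t : ℂ)) (γ := fun t => (1 - (t : ℂ)) • y) (by fun_prop) (by fun_prop)
      (by fun_prop) (hmem x hx)).differentiableWithinAt
  · have hc : ∀ a, ContinuousOn (fun t : ℝ => (x a - y a) *
        fderiv ℂ h ((t : ℂ) • x + (1 - (t : ℂ)) • y) (Pi.single a 1)) (Set.uIcc 0 1) := fun a =>
      continuousOn_const.mul ((hd a).continuousOn.comp (by fun_prop) (fun t ht => hmem x hx t ht))
    have hFTC := intervalIntegral.integral_eq_sub_of_hasDerivAt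
      (f := fun t : ℝ => h ((t : ℂ) • x + (1 - (t : ℂ)) • y)) (a := 0) (b := 1)
      (f' := fun t : ℝ => ∑ a, (x a - y a) *
        fderiv ℂ h ((t : ℂ) • x + (1 - (t : ℂ)) • y) (Pi.single a 1)) ?_
      (continuousOn_finsetSum _ fun a _ => hc a).intervalIntegrable
    · simp only [Complex.ofReal_one, one_smul, sub_self, zero_smul, add_zero, Complex.ofReal_zero,
        sub_zero, zero_add] at hFTC
      rw [intervalIntegral.integral_finsetSum fun a _ => (hc a).intervalIntegrable] at hFTC
      simp only [intervalIntegral.integral_const_mul] at hFTC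
      simp only [one_mul]
      rw [hFTC]; ring
    · intro t ht
      have h1 := (hh.differentiableAt (isOpen_ball.mem_nhds (hmem x hx t ht))).hasFDerivAt
      have h2 : HasDerivAt (fun t : ℝ => (t : ℂ) • x + (1 - (t : ℂ)) • y) (x - y) t := by
        have h3 : HasDerivAt (fun t : ℝ => (t : ℂ)) 1 t := Complex.ofRealCLM.hasDerivAt
        refine ((h3.smul_const x).add ((h3.const_sub 1).smul_const y)).congr_deriv ?_
        module
      have h4 := (h1.restrictScalars ℝ).comp_hasDerivAt t h2
      refine h4.congr_deriv ?_
      have e : x - y = ∑ a, (x a - y a) • (Pi.single a 1 : Fin p → ℂ) := by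
        rw [← Finset.univ_sum_single (x - y)]
        refine Finset.sum_congr rfl fun a _ => ?_
        rw [← Pi.single_smul]; simp
      rw [ContinuousLinearMap.coe_restrictScalars', e, map_sum]
      simp

end Holomorphic

/-! ### Derivations of superdomains -/

@[simp] theorem sgn_zero_left (j : ZMod 2) : sgn 0 j = 1 := by revert j; decide

@[simp] theorem sgn_zero_right (j : ZMod 2) : sgn j 0 = 1 := by revert j; decide

@[simp] theorem sgn_one_one : sgn 1 1 = -1 := by decide

/-! ### Contractions as odd derivations of an exterior algebra -/

section ExteriorContraction

open CliffordAlgebra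

variable {E : Type*} [AddCommGroup E] [Module ℂ E]

theorem contractLeft_mul (d : Module.Dual ℂ E) (x y : ExteriorAlgebra ℂ E) :
    contractLeft d (x * y) = contractLeft d x * y + involute x * contractLeft d y := by
  induction x using CliffordAlgebra.left_induction with
  | algebraMap r => simp [contractLeft_algebraMap_mul, contractLeft_algebraMap]
  | add x x' hx hx' => simp only [add_mul, map_add, hx, hx']; abel
  | ι_mul x m hx =>
    rw [mul_assoc, contractLeft_ι_mul, hx, contractLeft_ι_mul, map_mul, involute_ι, sub_mul,
      mul_add, smul_mul_assoc, neg_mul, neg_mul, mul_assoc, mul_assoc]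
    abel

/-- Turns the grade involution in `contractLeft_mul` into the Koszul sign of an odd derivation. -/
theorem involute_of_mem_evenOdd {i : ZMod 2} {x : ExteriorAlgebra ℂ E}
    (hx : x ∈ evenOdd (0 : QuadraticForm ℂ E) i) : involute x = sgn 1 i • x := by
  fin_cases i
  · change involute x = sgn 1 0 • x
    rw [sgn_zero_right, one_smul]
    exact involute_eq_of_mem_even hx
  · change involute x = sgn 1 1 • x
    rw [sgn_one_one, neg_one_smul]
    exact involute_eq_of_mem_odd hx

theorem contractLeft_mem_evenOdd (d : Module.Dual ℂ E) {i : ZMod 2} {x : ExteriorAlgebra ℂ E}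
    (hx : x ∈ evenOdd (0 : QuadraticForm ℂ E) i) :
    contractLeft d x ∈ evenOdd (0 : QuadraticForm ℂ E) (1 + i) := by
  induction x, hx using evenOdd_induction with
  | range_ι_pow v h =>
    fin_cases i
    · obtain ⟨r, rfl⟩ := Submodule.mem_one.mp h
      simp
    · have h : v ∈ LinearMap.range (ι (0 : QuadraticForm ℂ E)) ^ 1 := h
      rw [pow_one] at h
      obtain ⟨m, rfl⟩ := h
      rw [contractLeft_ι]
      exact SetLike.algebraMap_mem_graded (evenOdd (0 : QuadraticForm ℂ E)) _
  | add x y hx hy ihx ihy => rw [map_add]; exact add_mem ihx ihy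
  | ι_mul_ι_mul m₁ m₂ x hx ih =>
    rw [mul_assoc, contractLeft_ι_mul, contractLeft_ι_mul, mul_sub, ← mul_assoc, mul_smul_comm]
    have h1 := fun m => SetLike.mul_mem_graded (ι_mem_evenOdd_one (0 : QuadraticForm ℂ E) m) hx
    have h2 := SetLike.mul_mem_graded
      (ι_mul_ι_mem_evenOdd_zero (0 : QuadraticForm ℂ E) m₁ m₂) ih
    rw [zero_add] at h2
    exact sub_mem (Submodule.smul_mem _ _ (h1 m₂)) (sub_mem (Submodule.smul_mem _ _ (h1 m₁)) h2)

end ExteriorContraction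

/-! ### Superdomains and their coordinate derivations -/

section Model

variable {p q N : ℕ} {W : Opens (Fin p → ℂ)}

/-- The function `h · l` on a superdomain, `h` being holomorphic and `l` constant. -/
def Model.pure (h : (Fin p → ℂ) → ℂ) (hh : DifferentiableOn ℂ h (W : Set (Fin p → ℂ)))
    (l : Grassmann q N) : Model q N W :=
  ⟨fun x => h x • l, by
    have : (fun x : W => h x • l) =
        (fun x : W => algebraMap ℂ (Grassmann q N) (h x)) * fun _ => l := by
      funext x; simp [Algebra.smul_def]
    rw [this]
    exact mul_mem (Algebra.subset_adjoin (Or.inl ⟨h, hh, rfl⟩))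
      (Algebra.subset_adjoin (Or.inr ⟨l, rfl⟩))⟩

theorem Model.pure_mul_pure {h h' : (Fin p → ℂ) → ℂ}
    (hh : DifferentiableOn ℂ h (W : Set (Fin p → ℂ)))
    (hh' : DifferentiableOn ℂ h' (W : Set (Fin p → ℂ))) (l l' : Grassmann q N) :
    Model.pure h hh l * Model.pure h' hh' l' = Model.pure (h * h') (hh.mul hh') (l * l') := by
  apply Subtype.ext; funext x
  simp [Model.pure, mul_smul, smul_comm (h x.1)]

/-- The products `h · l` are closed under multiplication and contain both kinds of generators, so
their additive span is already the whole adjoined algebra. -/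
theorem Model.induction {P : Model q N W → Prop}
    (pure : ∀ h (hh : DifferentiableOn ℂ h (W : Set (Fin p → ℂ))) l, P (Model.pure h hh l))
    (add : ∀ f g, P f → P g → P (f + g)) (f : Model q N W) : P f := by
  have h0 : P 0 := by
    have := pure 0 (differentiableOn_const 0) 0
    rwa [show (Model.pure 0 (differentiableOn_const 0) 0 : Model q N W) = 0 from
      Subtype.ext (by funext x; simp [Model.pure])] at this
  set S : Set (Model q N W) := {f | ∃ h hh l, f = Model.pure h hh l} with hS
  suffices h : f ∈ AddSubmonoid.closure S by
    induction h using AddSubmonoid.closure_induction with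
    | mem f hf => obtain ⟨h, hh, l, rfl⟩ := hf; exact pure h hh l
    | zero => exact h0
    | add f g _ _ hf hg => exact add f g hf hg
  have key : ∀ g (hg : g ∈ Model q N W), (⟨g, hg⟩ : Model q N W) ∈ AddSubmonoid.closure S := by
    intro g hg
    have aux : ∀ f g : Model q N W, f ∈ AddSubmonoid.closure S → g ∈ AddSubmonoid.closure S →
        f * g ∈ AddSubmonoid.closure S := by
      intro f g hf hg
      induction hf using AddSubmonoid.closure_induction with
      | zero => simp
      | add f f' _ _ h h' => rw [add_mul]; exact add_mem h h'
      | mem f hf =>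
        obtain ⟨h, hh, l, rfl⟩ := hf
        induction hg using AddSubmonoid.closure_induction with
        | zero => simp
        | add f f' _ _ h h' => rw [mul_add]; exact add_mem h h'
        | mem f hf =>
          obtain ⟨h', hh', l', rfl⟩ := hf
          exact AddSubmonoid.subset_closure ⟨_, _, _, Model.pure_mul_pure hh hh' l l'⟩
    induction hg using Algebra.adjoin_induction with
    | mem f hf =>
      rcases hf with ⟨h, hh, rfl⟩ | ⟨l, rfl⟩
      · refine AddSubmonoid.subset_closure ⟨h, hh, 1, Subtype.ext ?_⟩
        funext x; simp [Model.pure, Algebra.algebraMap_eq_smul_one]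
      · refine AddSubmonoid.subset_closure ⟨1, differentiableOn_const 1, l, Subtype.ext ?_⟩
        funext x; simp [Model.pure]
    | algebraMap r =>
      refine AddSubmonoid.subset_closure ⟨fun _ => r, differentiableOn_const r, 1,
        Subtype.ext ?_⟩
      funext x; simp [Model.pure, Algebra.algebraMap_eq_smul_one]
    | add f g hf hg h h' => exact add_mem h h'
    | mul f g hf hg h h' => exact aux ⟨f, hf⟩ ⟨g, hg⟩ h h'
  exact key f.1 f.2

/-- A superderivation of parity `i`, over the constants, of the sheaf of functions on the
superdomains of dimension `p|q`. -/
structure IsModelDer (i : ZMod 2)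
    (D : ∀ W : Opens (Fin p → ℂ), Model q N W →ₗ[ℂ] Model q N W) : Prop where
  res : ∀ {W' W : Opens (Fin p → ℂ)} (h : W' ≤ W) (f : Model q N W) (f' : Model q N W'),
    (∀ x : W', f'.1 x = f.1 ⟨x.1, h x.2⟩) → ∀ x : W', (D W' f').1 x = (D W f).1 ⟨x.1, h x.2⟩
  parity : ∀ {W : Opens (Fin p → ℂ)} {j : ZMod 2} {f : Model q N W}, Model.HasParity j f →
    Model.HasParity (i + j) (D W f)
  const : ∀ {W : Opens (Fin p → ℂ)} (l : ExteriorAlgebra ℂ (Fin N → ℂ)),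
    D W (Model.const q N W l) = 0
  leibniz : ∀ {W : Opens (Fin p → ℂ)} {j : ZMod 2} {f : Model q N W} (g : Model q N W),
    Model.HasParity j f → D W (f * g) = D W f * g + sgn i j • (f * D W g)

/-- `g` is the derivative of `f` in the direction `v`. -/
def Model.IsPartial (v : Fin p → ℂ) (f g : Model q N W) : Prop :=
  ∀ (l : Module.Dual ℂ (Grassmann q N)) (x : W),
    -- Linear functionals reduce Grassmann-valued derivatives to scalar ones. The value `0` outside
    -- `W` has no influence, because `W` is open.
    HasLineDerivAt ℂ (fun y => open Classical in if h : y ∈ W then l (f.1 ⟨y, h⟩) else 0)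
      (l (g.1 x)) x.1 v

namespace Model.IsPartial

variable {v : Fin p → ℂ}

theorem unique {f g g' : Model q N W} (h : IsPartial v f g) (h' : IsPartial v f g') : g = g' := by
  apply Subtype.ext; funext x
  rw [← sub_eq_zero, ← Module.forall_dual_apply_eq_zero_iff ℂ]
  intro l
  rw [map_sub, (h l x).unique (h' l x), sub_self]

theorem add {f f' g g' : Model q N W} (h : IsPartial v f g) (h' : IsPartial v f' g') :
    IsPartial v (f + f') (g + g') := by
  intro l x
  have := HasDerivAt.add (h l x) (h' l x)
  refine (this.congr_deriv (by simp)).congr_of_eventuallyEq (.of_forall fun t => ?_)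
  by_cases ht : x.1 + t • v ∈ W <;> simp [ht]

theorem smul (c : ℂ) {f g : Model q N W} (h : IsPartial v f g) :
    IsPartial v (c • f) (c • g) := by
  intro l x
  have := HasDerivAt.const_mul c (h l x)
  refine (this.congr_deriv (by simp)).congr_of_eventuallyEq (.of_forall fun t => ?_)
  by_cases ht : x.1 + t • v ∈ W <;> simp [ht]

theorem eventually_mem (x : W) (v : Fin p → ℂ) :
    ∀ᶠ t : ℂ in nhds 0, x.1 + t • v ∈ W := by
  have hc : Continuous fun t : ℂ => x.1 + t • v := by fun_prop
  exact hc.continuousAt.eventually_mem (W.2.mem_nhds (by simp))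

theorem of_pure (v : Fin p → ℂ) {h : (Fin p → ℂ) → ℂ}
    (hh : DifferentiableOn ℂ h (W : Set (Fin p → ℂ))) (l : Grassmann q N) :
    IsPartial v (Model.pure (W := W) h hh l)
      (Model.pure _ (differentiableOn_fderiv_apply W.2 hh v) l) := by
  intro m x
  have h1 := hasLineDerivAt_of_differentiableOn W.2 hh x.2 v
  have h2 := HasDerivAt.mul_const h1 (m l)
  refine (h2.congr_deriv (by simp [Model.pure])).congr_of_eventuallyEq ?_
  filter_upwards [eventually_mem x v] with t ht
  simp [ht, Model.pure]

end Model.IsPartial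

theorem Model.exists_isPartial (v : Fin p → ℂ) (f : Model q N W) :
    ∃ g : Model q N W, Model.IsPartial v f g := by
  induction f using Model.induction with
  | pure h hh l => exact ⟨_, .of_pure v hh l⟩
  | add f f' hf hf' =>
    obtain ⟨g, hg⟩ := hf
    obtain ⟨g', hg'⟩ := hf'
    exact ⟨_, hg.add hg'⟩

/-- The derivative in the direction `v ∈ ℂ^p`. -/
noncomputable def Model.partialDeriv (q N : ℕ) (v : Fin p → ℂ) (W : Opens (Fin p → ℂ)) :
    Model q N W →ₗ[ℂ] Model q N W where
  toFun f := (Model.exists_isPartial v f).choose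
  map_add' f g := (Model.exists_isPartial v (f + g)).choose_spec.unique
    ((Model.exists_isPartial v f).choose_spec.add (Model.exists_isPartial v g).choose_spec)
  map_smul' c f := (Model.exists_isPartial v (c • f)).choose_spec.unique
    ((Model.exists_isPartial v f).choose_spec.smul c)

theorem Model.isPartial_partialDeriv (v : Fin p → ℂ) (f : Model q N W) :
    Model.IsPartial v f (Model.partialDeriv q N v W f) :=
  (Model.exists_isPartial v f).choose_spec

theorem Model.partialDeriv_eq {v : Fin p → ℂ} {f g : Model q N W} (h : Model.IsPartial v f g) :
    Model.partialDeriv q N v W f = g :=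
  (Model.isPartial_partialDeriv v f).unique h

theorem Model.const_eq_pure (l : ExteriorAlgebra ℂ (Fin N → ℂ)) :
    Model.const q N W l = Model.pure (fun _ => 1) (differentiableOn_const 1)
      (ExteriorAlgebra.map (thetaIncl q N) l) := by
  apply Subtype.ext; funext x; simp [Model.pure, Model.const]

theorem Model.coord_inl_eq_pure (a : Fin p) :
    Model.coord q N W (.inl a) = Model.pure (fun x => x a)
      (differentiable_apply a).differentiableOn 1 := by
  apply Subtype.ext; funext x; simp [Model.pure, Model.coord, Algebra.algebraMap_eq_smul_one]

theorem Model.coord_inr_eq_pure (j : Fin q) :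
    Model.coord q N W (.inr j) = Model.pure (fun _ => 1) (differentiableOn_const 1)
      (ExteriorAlgebra.ι ℂ (Pi.single (Sum.inl j) 1)) := by
  apply Subtype.ext; funext x; simp [Model.pure, Model.coord]

theorem Model.partialDeriv_pure_one (v : Fin p → ℂ) (l : Grassmann q N) :
    Model.partialDeriv q N v W (Model.pure (fun _ => 1) (differentiableOn_const 1) l) = 0 := by
  rw [Model.partialDeriv_eq (.of_pure v _ l)]
  apply Subtype.ext; funext x; simp [Model.pure]

theorem isModelDer_partialDeriv (v : Fin p → ℂ) :
    IsModelDer 0 (Model.partialDeriv q N v) where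
  res {W' W} h f f' hf x := by
    rw [← sub_eq_zero, ← Module.forall_dual_apply_eq_zero_iff ℂ]
    intro l
    rw [map_sub, sub_eq_zero]
    refine (Model.isPartial_partialDeriv v f' l x).unique
      ((Model.isPartial_partialDeriv v f l ⟨x.1, h x.2⟩).congr_of_eventuallyEq ?_)
    filter_upwards [W'.2.mem_nhds x.2] with y hy
    have hy : y ∈ W' := hy
    simp [hy, h hy, hf ⟨y, hy⟩]
  parity {W j f} hf x := by
    rw [zero_add]
    by_contra hx
    -- A functional that kills the graded piece but not the derivative: along `f` it is identically
    -- zero, so its derivative is zero, a contradiction.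
    obtain ⟨l, hl, hker⟩ := Submodule.exists_le_ker_of_notMem hx
    refine hl ((Model.isPartial_partialDeriv v f l x).unique
      ((hasDerivAt_const (0 : ℂ) (0 : ℂ)).congr_of_eventuallyEq (.of_forall fun t => ?_)))
    by_cases ht : x.1 + t • v ∈ W
    · simpa [ht] using hker (hf ⟨_, ht⟩)
    · simp [ht]
  const l := by rw [Model.const_eq_pure, Model.partialDeriv_pure_one]
  leibniz {W j f} g hf := by
    rw [sgn_zero_left, one_smul]
    -- The sign being trivial, homogeneity is no longer needed, and the induction may split `f` into
    -- arbitrary summands.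
    clear hf
    induction f using Model.induction with
    | add f f' hf hf' => rw [add_mul, map_add, hf, hf', map_add, add_mul, add_mul]; abel
    | pure h hh l =>
      induction g using Model.induction with
      | add g g' hg hg' => rw [mul_add, map_add, hg, hg', map_add, mul_add, mul_add]; abel
      | pure h' hh' l' =>
        rw [Model.pure_mul_pure, Model.partialDeriv_eq (.of_pure v _ _),
          Model.partialDeriv_eq (.of_pure v _ _), Model.partialDeriv_eq (.of_pure v _ _),
          Model.pure_mul_pure, Model.pure_mul_pure]
        apply Subtype.ext; funext x
        have e := fderiv_mul (hh.differentiableAt (W.2.mem_nhds x.2))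
          (hh'.differentiableAt (W.2.mem_nhds x.2))
        simp only [Model.pure, e, Subalgebra.coe_add, Pi.add_apply, ← add_smul, Pi.mul_apply]
        congr 1
        simp only [add_apply, smul_apply, smul_eq_mul]
        ring

/-- The contraction with the functional `d` on the span of the odd generators. -/
noncomputable def Model.contract (p q N : ℕ) (d : Module.Dual ℂ (Fin q ⊕ Fin N → ℂ))
    (W : Opens (Fin p → ℂ)) : Model q N W →ₗ[ℂ] Model q N W where
  toFun f := ⟨fun x => CliffordAlgebra.contractLeft d (f.1 x), by
    induction f using Model.induction with
    | pure h hh l =>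
      convert (Model.pure h hh (CliffordAlgebra.contractLeft d l)).2 using 1
      funext x; simp [Model.pure]
    | add f g hf hg =>
      convert add_mem hf hg using 1
      funext x; simp⟩
  map_add' f g := by apply Subtype.ext; funext x; simp
  map_smul' c f := by apply Subtype.ext; funext x; simp

/-- The condition on `d` is that it vanishes on the `θ_k`; the contraction is then a derivation over
`Λ_N` and not merely over `ℂ`. -/
theorem isModelDer_contract {d : Module.Dual ℂ (Fin q ⊕ Fin N → ℂ)}
    (hd : d ∘ₗ thetaIncl q N = 0) : IsModelDer 1 (Model.contract p q N d) where
  res h f f' hf x := by simp [Model.contract, hf]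
  parity hf x := contractLeft_mem_evenOdd d (hf x)
  const l := by
    apply Subtype.ext; funext x
    change CliffordAlgebra.contractLeft d (ExteriorAlgebra.map (thetaIncl q N) l) = 0
    induction l using ExteriorAlgebra.induction with
    | algebraMap r => rw [AlgHom.commutes, CliffordAlgebra.contractLeft_algebraMap]
    | ι t =>
      rw [ExteriorAlgebra.map_apply_ι]
      refine (CliffordAlgebra.contractLeft_ι _ d _).trans ?_
      rw [show d (thetaIncl q N t) = 0 from LinearMap.congr_fun hd t, map_zero]
    | mul a b ha hb => rw [map_mul, contractLeft_mul, ha, hb]; simp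
    | add a b ha hb => rw [map_add, map_add, ha, hb, add_zero]
  leibniz {W j f} g hf := by
    apply Subtype.ext; funext x
    change CliffordAlgebra.contractLeft d (f.1 x * g.1 x) = _
    rw [contractLeft_mul, involute_of_mem_evenOdd (hf x), smul_mul_assoc]
    rfl

/-- The parity of the coordinate with index `a`. -/
def indexParity {r s : ℕ} : Fin r ⊕ Fin s → ZMod 2 := Sum.elim (fun _ => 0) fun _ => 1

theorem Model.hasParity_coord (a : Fin p ⊕ Fin q) :
    Model.HasParity (indexParity a) (Model.coord q N W a) := by
  intro x
  rcases a with a | j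
  · exact SetLike.algebraMap_mem_graded
      (CliffordAlgebra.evenOdd (0 : QuadraticForm ℂ (Fin q ⊕ Fin N → ℂ))) _
  · exact CliffordAlgebra.ι_mem_evenOdd_one (0 : QuadraticForm ℂ (Fin q ⊕ Fin N → ℂ)) _

/-- The coordinate derivations of a superdomain. -/
theorem exists_isModelDer_coord (p q N : ℕ) (a : Fin p ⊕ Fin q) :
    ∃ D : ∀ W : Opens (Fin p → ℂ), Model q N W →ₗ[ℂ] Model q N W,
      IsModelDer (indexParity a) D ∧
        ∀ W c, D W (Model.coord q N W c) = if a = c then 1 else 0 := by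
  rcases a with a | j
  · refine ⟨_, isModelDer_partialDeriv (Pi.single a 1), fun W c => ?_⟩
    rcases c with c | k
    · rw [Model.coord_inl_eq_pure, Model.partialDeriv_eq (.of_pure _ _ _)]
      apply Subtype.ext; funext x
      have : fderiv ℂ (fun x : Fin p → ℂ => x c) x.1 = ContinuousLinearMap.proj c :=
        (ContinuousLinearMap.proj (R := ℂ) (φ := fun _ : Fin p => ℂ) c).hasFDerivAt.fderiv
      rcases eq_or_ne a c with rfl | hac
      · simp [Model.pure, this]
      · simp [Model.pure, this, hac, hac.symm]
    · rw [Model.coord_inr_eq_pure, Model.partialDeriv_pure_one]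
      simp
  · refine ⟨_, isModelDer_contract (d := LinearMap.proj (Sum.inl j)) ?_, fun W c => ?_⟩
    · ext t; simp [thetaIncl]
    · apply Subtype.ext; funext x
      rcases c with c | k
      · exact (CliffordAlgebra.contractLeft_algebraMap _ _ _).trans (by simp)
      · refine (CliffordAlgebra.contractLeft_ι _ _ _).trans ?_
        rcases eq_or_ne j k with rfl | hjk
        · simp
        · simp [hjk]

end Model

/-! ### Vector fields in coordinates -/

variable {N : ℕ} {M : Type u} [TopologicalSpace M]

namespace SuperSheaf

variable {𝒪 : SuperSheaf.{u, v} N M}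

theorem exists_parity_add {U : Opens M} (f : 𝒪.Sec U) :
    ∃ f0 ∈ 𝒪.parity U 0, ∃ f1 ∈ 𝒪.parity U 1, f0 + f1 = f :=
  Submodule.mem_sup.1 ((𝒪.isCompl_parity U).sup_eq_top ▸ Submodule.mem_top :
    f ∈ 𝒪.parity U 0 ⊔ 𝒪.parity U 1)

theorem eq_zero_of_mem_parity {U : Opens M} {i j : ZMod 2} (hij : i ≠ j) {f : 𝒪.Sec U}
    (hi : f ∈ 𝒪.parity U i) (hj : f ∈ 𝒪.parity U j) : f = 0 := by
  have d := Submodule.disjoint_def.1 (𝒪.isCompl_parity U).disjoint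
  fin_cases i <;> fin_cases j
  · exact absurd rfl hij
  · exact d f hi hj
  · exact d f hj hi
  · exact absurd rfl hij

theorem eq_zero_of_add_eq_zero {U : Opens M} {i j : ZMod 2} (hij : i ≠ j) {f g : 𝒪.Sec U}
    (hf : f ∈ 𝒪.parity U i) (hg : g ∈ 𝒪.parity U j) (h : f + g = 0) : f = 0 ∧ g = 0 := by
  have hf0 : f = 0 := eq_zero_of_mem_parity hij hf (by
    rw [eq_neg_of_add_eq_zero_left h]; exact neg_mem hg)
  exact ⟨hf0, by simpa [hf0] using h⟩

namespace IsDer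

variable {U : Opens M} {i : ZMod 2} {X : 𝒪.Op U} (hX : 𝒪.IsDer i X)

-- The Leibniz rule needs a homogeneous left factor. If `X f = 0`, then the images of the even and
-- odd parts of `f` have different parities and sum to zero, so both vanish.
include hX in
theorem apply_mul_eq_zero {V : Opens M} (h : V ≤ U) {f g : 𝒪.Sec V} (hf : X ⟨V, h⟩ f = 0)
    (hg : X ⟨V, h⟩ g = 0) : X ⟨V, h⟩ (f * g) = 0 := by
  obtain ⟨f0, h0, f1, h1, rfl⟩ := exists_parity_add f
  rw [map_add] at hf
  obtain ⟨e0, e1⟩ := eq_zero_of_add_eq_zero ((add_right_injective i).ne zero_ne_one) (hX.parity h h0)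
    (hX.parity h h1) hf
  rw [add_mul, map_add, hX.leibniz h g h0, hX.leibniz h g h1, e0, e1, hg]
  simp

/-- The functions killed by a derivation. -/
def ker {V : Opens M} (h : V ≤ U) : Subalgebra ℂ (𝒪.Sec V) where
  carrier := {f | X ⟨V, h⟩ f = 0}
  mul_mem' hf hg := hX.apply_mul_eq_zero h hf hg
  add_mem' {f g} hf hg := by
    change X ⟨V, h⟩ (f + g) = 0
    rw [map_add, show X ⟨V, h⟩ f = 0 from hf, show X ⟨V, h⟩ g = 0 from hg, add_zero]
  algebraMap_mem' r := by
    have := hX.const h (algebraMap ℂ _ r)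
    rwa [AlgHom.commutes] at this

end IsDer

@[simp] theorem VF.smul_app {U : Opens M} (f : 𝒪.Sec U) (X : 𝒪.VF U) (g : 𝒪.Sec U) :
    VF.app (f • X) g = f * VF.app X g := by
  change 𝒪.res le_rfl f * _ = _
  rw [𝒪.res_self]; rfl

@[simp] theorem VF.add_app {U : Opens M} (X Y : 𝒪.VF U) (g : 𝒪.Sec U) :
    VF.app (X + Y) g = VF.app X g + VF.app Y g := rfl

theorem VF.sum_app {U : Opens M} {ι : Type*} (s : Finset ι) (X : ι → 𝒪.VF U) (g : 𝒪.Sec U) :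
    VF.app (∑ a ∈ s, X a) g = ∑ a ∈ s, VF.app (X a) g :=
  map_sum (⟨⟨fun X => VF.app X g, rfl⟩, fun _ _ => rfl⟩ : 𝒪.VF U →+ 𝒪.Sec U) X s

theorem VF.exists_homogeneous_add {U : Opens M} (X : 𝒪.VF U) :
    ∃ (X0 : 𝒪.HVF 0 U) (X1 : 𝒪.HVF 1 U), X = X0.toVF + X1.toVF := by
  obtain ⟨X0, h0, X1, h1, e⟩ := AddSubgroup.mem_sup.1 X.2
  exact ⟨⟨X0, h0⟩, ⟨X1, h1⟩, Subtype.ext e.symm⟩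

theorem VF.apply_res {U V W : Opens M} (X : 𝒪.VF U) (hV : V ≤ U) (h : W ≤ V) (f : 𝒪.Sec V) :
    𝒪.res h (X.1 ⟨V, hV⟩ f) = X.1 ⟨W, h.trans hV⟩ (𝒪.res h f) := by
  obtain ⟨X0, X1, rfl⟩ := X.exists_homogeneous_add
  have e0 := IsDer.res X0.2 h hV f
  have e1 := IsDer.res X1.2 h hV f
  change 𝒪.res h (X0.1 ⟨V, hV⟩ f + X1.1 ⟨V, hV⟩ f) = _
  rw [map_add, e0, e1]
  rfl

theorem VF.res_app {U V : Opens M} (X : 𝒪.VF U) (h : V ≤ U) (f : 𝒪.Sec U) :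
    𝒪.res h (VF.app X f) = VF.app (VF.res h X) (𝒪.res h f) :=
  X.apply_res le_rfl h f

/-- Restriction to an equal open subset. -/
def resEquiv (𝒪 : SuperSheaf.{u, v} N M) {U V : Opens M} (e : U = V) :
    𝒪.Sec V ≃ₐ[ℂ] 𝒪.Sec U :=
  AlgEquiv.ofAlgHom (𝒪.res e.le) (𝒪.res e.ge)
    (by ext f; simp [𝒪.res_res, 𝒪.res_self]) (by ext f; simp [𝒪.res_res, 𝒪.res_self])

end SuperSheaf

/-! ### Charts: vector fields and their values on coordinates -/

namespace SuperChart

variable {𝒪 : SuperSheaf.{u, v} N M} {p q : ℕ} (χ : SuperChart 𝒪 p q)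

/-- The subset of the image of the chart which corresponds to `V`. -/
def dom (V : Opens M) : Opens (Fin p → ℂ) :=
  ⟨χ.φ.target ∩ χ.φ.symm ⁻¹' V, χ.φ.isOpen_inter_preimage_symm V.2⟩

theorem dom_le (V : Opens M) : χ.dom V ≤ imageOpen χ.φ := fun _ h => h.1

theorem dom_mono {V' V : Opens M} (h : V' ≤ V) : χ.dom V' ≤ χ.dom V := fun _ hx =>
  ⟨hx.1, h hx.2⟩

theorem pullOpen_dom {V : Opens M} (hV : V ≤ χ.source) : pullOpen χ.φ (χ.dom V) = V := by
  ext x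
  constructor
  · rintro ⟨h1, h2, h3⟩
    have h3 : χ.φ.symm (χ.φ x) ∈ V := h3
    rwa [χ.φ.left_inv h1] at h3
  · intro hx
    have h1 := (hV hx).1
    refine ⟨h1, χ.φ.map_source h1, ?_⟩
    change χ.φ.symm (χ.φ x) ∈ V
    rwa [χ.φ.left_inv h1]

/-- The functions on `V`, in coordinates. -/
def isoOn {V : Opens M} (hV : V ≤ χ.source) : 𝒪.Sec V ≃ₐ[ℂ] Model q N (χ.dom V) :=
  (𝒪.resEquiv (χ.pullOpen_dom hV)).trans (χ.iso (χ.dom V) (χ.dom_le V))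

theorem isoOn_apply {V : Opens M} (hV : V ≤ χ.source) (f : 𝒪.Sec V) :
    χ.isoOn hV f = χ.iso (χ.dom V) (χ.dom_le V) (𝒪.res (χ.pullOpen_dom hV).le f) := rfl

theorem isoOn_res {V' V : Opens M} (h : V' ≤ V) (hV : V ≤ χ.source) (f : 𝒪.Sec V)
    (x : χ.dom V') :
    (χ.isoOn (h.trans hV) (𝒪.res h f)).1 x = (χ.isoOn hV f).1 ⟨x.1, χ.dom_mono h x.2⟩ := by
  rw [isoOn_apply, isoOn_apply, 𝒪.res_res,
    ← χ.iso_res (χ.dom_mono h) (χ.dom_le V), 𝒪.res_res]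

theorem isoOn_const {V : Opens M} (hV : V ≤ χ.source) (l : ExteriorAlgebra ℂ (Fin N → ℂ)) :
    χ.isoOn hV (𝒪.const V l) = Model.const q N (χ.dom V) l := by
  rw [isoOn_apply, 𝒪.res_const, χ.iso_const]

theorem isoOn_coord {V : Opens M} (hV : V ≤ χ.source) (a : Fin p ⊕ Fin q) :
    χ.isoOn hV (𝒪.res hV (χ.coord a)) = Model.coord q N (χ.dom V) a := by
  rw [isoOn_apply, 𝒪.res_res]
  apply Subtype.ext; funext x
  refine (χ.iso_res (χ.dom_le V) le_rfl (χ.coord a) x).trans ?_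
  rw [coord, AlgEquiv.apply_symm_apply]
  rcases a with a | j <;> rfl

theorem hasParity_isoOn {V : Opens M} (hV : V ≤ χ.source) {i : ZMod 2} {f : 𝒪.Sec V}
    (hf : f ∈ 𝒪.parity V i) : Model.HasParity i (χ.isoOn hV f) :=
  χ.iso_parity (χ.dom_le V) (𝒪.res_parity _ hf)

/-- Charts are assumed to preserve parity in one direction only. For the converse, the component of
the wrong parity has an image that is both even and odd, hence zero, and the chart is injective. -/
theorem mem_parity_of_hasParity {V : Opens M} (hV : V ≤ χ.source) {i : ZMod 2} {f : 𝒪.Sec V}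
    (hf : Model.HasParity i (χ.isoOn hV f)) : f ∈ 𝒪.parity V i := by
  have hd := Submodule.disjoint_def.1
    (CliffordAlgebra.evenOdd_isCompl (0 : QuadraticForm ℂ (Fin q ⊕ Fin N → ℂ))).disjoint
  obtain ⟨f0, h0, f1, h1, rfl⟩ := SuperSheaf.exists_parity_add f
  have g0 := χ.hasParity_isoOn hV h0
  have g1 := χ.hasParity_isoOn hV h1
  rw [map_add] at hf
  fin_cases i
  · have : f1 = 0 := by
      rw [← map_eq_zero_iff _ (χ.isoOn hV).injective]
      apply Subtype.ext; funext x
      refine hd _ ?_ (g1 x)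
      have := sub_mem (hf x) (g0 x)
      rwa [Subalgebra.coe_add, Pi.add_apply, add_sub_cancel_left] at this
    rw [this, add_zero]; exact h0
  · have : f0 = 0 := by
      rw [← map_eq_zero_iff _ (χ.isoOn hV).injective]
      apply Subtype.ext; funext x
      refine hd _ (g0 x) ?_
      have := sub_mem (hf x) (g1 x)
      rwa [Subalgebra.coe_add, Pi.add_apply, add_sub_cancel_right] at this
    rw [this, zero_add]; exact h1

theorem coord_mem_parity (a : Fin p ⊕ Fin q) :
    χ.coord a ∈ 𝒪.parity χ.source (indexParity a) := by
  apply χ.mem_parity_of_hasParity le_rfl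
  rw [← 𝒪.res_self (χ.coord a), χ.isoOn_coord]
  exact Model.hasParity_coord a

/-- The derivation of the domain of a chart given by a derivation of superdomains. -/
def opOfModel (D : ∀ W : Opens (Fin p → ℂ), Model q N W →ₗ[ℂ] Model q N W) :
    𝒪.Op χ.source := fun V =>
  (χ.isoOn V.2).symm.toLinearMap ∘ₗ D (χ.dom V.1) ∘ₗ (χ.isoOn V.2).toLinearMap

theorem isoOn_opOfModel (D : ∀ W : Opens (Fin p → ℂ), Model q N W →ₗ[ℂ] Model q N W)
    {V : Opens M} (hV : V ≤ χ.source) (f : 𝒪.Sec V) :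
    χ.isoOn hV (χ.opOfModel D ⟨V, hV⟩ f) = D (χ.dom V) (χ.isoOn hV f) :=
  (χ.isoOn hV).apply_symm_apply _

theorem isDer_opOfModel {i : ZMod 2}
    {D : ∀ W : Opens (Fin p → ℂ), Model q N W →ₗ[ℂ] Model q N W} (hD : IsModelDer i D) :
    𝒪.IsDer i (χ.opOfModel D) where
  res {W V} h hV f := by
    apply (χ.isoOn (h.trans hV)).injective
    apply Subtype.ext; funext x
    rw [isoOn_res, isoOn_opOfModel, isoOn_opOfModel]
    exact (hD.res (χ.dom_mono h) _ _ (χ.isoOn_res h hV f) x).symm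
  parity {V} hV j f hf := by
    apply χ.mem_parity_of_hasParity hV
    rw [isoOn_opOfModel]
    exact hD.parity (χ.hasParity_isoOn hV hf)
  const {V} hV l := by
    apply (χ.isoOn hV).injective
    rw [isoOn_opOfModel, isoOn_const, hD.const, map_zero]
  leibniz {V} hV j f g hf := by
    apply (χ.isoOn hV).injective
    rw [isoOn_opOfModel, map_mul, hD.leibniz _ (χ.hasParity_isoOn hV hf), map_add, map_zsmul,
      map_mul, map_mul, isoOn_opOfModel, isoOn_opOfModel]

/-- The coordinate vector fields. -/
theorem exists_coordVF (a : Fin p ⊕ Fin q) :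
    ∃ X : 𝒪.VF χ.source, ∀ c, X.app (χ.coord c) = if a = c then 1 else 0 := by
  obtain ⟨D, hD, hDc⟩ := exists_isModelDer_coord p q N a
  refine ⟨⟨χ.opOfModel D, SuperSheaf.der_le _ _ (χ.isDer_opOfModel hD)⟩, fun c => ?_⟩
  apply (χ.isoOn le_rfl).injective
  have := χ.isoOn_coord le_rfl c
  rw [𝒪.res_self] at this
  refine (χ.isoOn_opOfModel D le_rfl _).trans ?_
  rw [this, hDc]
  split_ifs <;> simp

section Unique

variable {χ} {U : Opens M} {i : ZMod 2} {X : 𝒪.Op U} (hX : 𝒪.IsDer i X) (hU : U ≤ χ.source)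
  (hc : ∀ a, X ⟨U, le_rfl⟩ (𝒪.res hU (χ.coord a)) = 0)

include hX hc

theorem coord_mem_ker {V : Opens M} (hV : V ≤ U) (a : Fin p ⊕ Fin q) :
    𝒪.res (hV.trans hU) (χ.coord a) ∈ hX.ker hV := by
  have := hX.res hV le_rfl (𝒪.res hU (χ.coord a))
  rw [hc, map_zero, 𝒪.res_res] at this
  exact this.symm

/-- The `ξ_j` are killed as coordinates and the `θ_k` as constants; the kernel is a subalgebra. -/
theorem grassmann_mem_ker {V : Opens M} (hV : V ≤ U) (l : Grassmann q N) :
    (χ.isoOn (hV.trans hU)).symm (Model.pure (fun _ => 1) (differentiableOn_const 1) l) ∈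
      hX.ker hV := by
  induction l using ExteriorAlgebra.induction with
  | algebraMap r =>
    convert (hX.ker hV).algebraMap_mem r using 1
    rw [AlgEquiv.symm_apply_eq, AlgEquiv.commutes]
    apply Subtype.ext; funext x
    simp [Model.pure]
  | ι w =>
    have e : (χ.isoOn (hV.trans hU)).symm (Model.pure (fun _ => 1) (differentiableOn_const 1)
        (ExteriorAlgebra.ι ℂ w)) =
        ∑ j, w (.inl j) • 𝒪.res (hV.trans hU) (χ.coord (.inr j)) +
          𝒪.const V (ExteriorAlgebra.ι ℂ fun k => w (.inr k)) := by
      rw [AlgEquiv.symm_apply_eq, map_add, map_sum, isoOn_const]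
      simp only [map_smul, isoOn_coord]
      apply Subtype.ext; funext x
      have hw : w = ∑ j, w (.inl j) • Pi.single (Sum.inl j) 1 +
          thetaIncl q N fun k => w (.inr k) := by
        ext (j | k)
        · simp [thetaIncl, Finset.sum_apply, Pi.single_apply]
        · simp [thetaIncl, Finset.sum_apply]
      simp only [Model.pure, one_smul, Model.coord, Model.const, Subalgebra.coe_add,
        AddSubmonoidClass.coe_finsetSum, Subalgebra.coe_smul, Pi.add_apply, Finset.sum_apply,
        Pi.smul_apply, ExteriorAlgebra.map_apply_ι]
      conv_lhs => rw [hw]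
      simp only [map_add, map_sum, map_smul]
    rw [e]
    exact add_mem (sum_mem fun j _ => (hX.ker hV).smul_mem (coord_mem_ker hX hU hc hV _) _)
      (hX.const hV _)
  | mul a b ha hb =>
    convert mul_mem ha hb using 1
    rw [← map_mul, Model.pure_mul_pure]
    congr 1
    apply Subtype.ext; funext x
    simp [Model.pure]
  | add a b ha hb =>
    convert add_mem ha hb using 1
    rw [← map_add]
    congr 1
    apply Subtype.ext; funext x
    simp [Model.pure]

/-- Functions on a superdomain are determined by their Grassmann values at points, so it is enough
that `X f` vanishes at each `y`. Hadamard's lemma on a ball around `y`, which forces a passage to a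
smaller open set, writes `f` as a constant plus `Σ (x_a - y_a) g_a`. -/
theorem holomorphic_mem_ker {V : Opens M} (hV : V ≤ U) {h : (Fin p → ℂ) → ℂ}
    (hh : DifferentiableOn ℂ h (χ.dom V : Set (Fin p → ℂ))) :
    (χ.isoOn (hV.trans hU)).symm (Model.pure h hh 1) ∈ hX.ker hV := by
  set f := (χ.isoOn (hV.trans hU)).symm (Model.pure h hh 1) with hf
  have hfiso : χ.isoOn (hV.trans hU) f = Model.pure h hh 1 := AlgEquiv.apply_symm_apply _ _
  change X ⟨V, hV⟩ f = 0
  apply (χ.isoOn (hV.trans hU)).injective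
  rw [map_zero]
  apply Subtype.ext; funext y
  obtain ⟨ε, hε, hεV⟩ := Metric.isOpen_iff.1 (χ.dom V).2 y.1 y.2
  obtain ⟨g, hg, hgh⟩ := exists_eq_add_sum_sub_mul (hh.mono hεV)
  set W : Opens (Fin p → ℂ) := ⟨Metric.ball y.1 ε, Metric.isOpen_ball⟩
  set V' := pullOpen χ.φ W
  have hV' : V' ≤ V := by
    rintro x ⟨h1, h2⟩
    have h3 : χ.φ.symm (χ.φ x) ∈ V := (hεV h2).2
    rwa [χ.φ.left_inv h1] at h3
  have hdom : χ.dom V' ≤ W := by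
    rintro x ⟨h1, h2, h3⟩
    have h3 : χ.φ (χ.φ.symm x) ∈ W := h3
    rwa [χ.φ.right_inv h1] at h3
  have hy : y.1 ∈ χ.dom V' := by
    refine ⟨y.2.1, χ.φ.map_target y.2.1, ?_⟩
    change χ.φ (χ.φ.symm y.1) ∈ W
    rw [χ.φ.right_inv y.2.1]
    exact Metric.mem_ball_self hε
  have hV'U := hV'.trans hV
  set G : Fin p → 𝒪.Sec V' := fun a => (χ.isoOn (hV'U.trans hU)).symm
    (Model.pure (g a) ((hg a).mono hdom) 1) with hG
  set C : Fin p → 𝒪.Sec V' := fun a => 𝒪.res (hV'U.trans hU) (χ.coord (.inl a)) -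
    algebraMap ℂ _ (y.1 a) with hC
  have hCker : ∀ a, X ⟨V', hV'U⟩ (C a) = 0 := fun a =>
    sub_mem (coord_mem_ker hX hU hc hV'U (.inl a)) ((hX.ker hV'U).algebraMap_mem _)
  have hCeven : ∀ a, C a ∈ 𝒪.parity V' 0 := fun a => by
    refine sub_mem (𝒪.res_parity _ (χ.coord_mem_parity (.inl a))) ?_
    rw [Algebra.algebraMap_eq_smul_one]
    exact Submodule.smul_mem _ _ (𝒪.one_mem V')
  have hCiso : ∀ a, χ.isoOn (hV'U.trans hU) (C a) =
      Model.coord q N _ (.inl a) - algebraMap ℂ _ (y.1 a) := fun a => by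
    rw [hC, map_sub, isoOn_coord, AlgEquiv.commutes]
  have hfres : 𝒪.res hV' f = algebraMap ℂ _ (h y.1) + ∑ a, C a * G a := by
    apply (χ.isoOn (hV'U.trans hU)).injective
    rw [map_add, AlgEquiv.commutes, map_sum]
    simp only [map_mul, hCiso, hG, AlgEquiv.apply_symm_apply]
    apply Subtype.ext; funext x
    rw [χ.isoOn_res hV' (hV.trans hU), hfiso]
    simp only [Model.pure, Model.coord, Subalgebra.coe_add, Subalgebra.coe_algebraMap,
      Pi.add_apply, Pi.algebraMap_apply, AddSubmonoidClass.coe_finsetSum, Finset.sum_apply,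
      Subalgebra.coe_mul, Subalgebra.coe_sub, Pi.mul_apply, Pi.sub_apply, hgh x.1 (hdom x.2),
      ← Algebra.algebraMap_eq_smul_one, map_add, map_sum, map_mul, map_sub]
  -- The factors `C a = x_a - y_a` are even and killed by `X`, so only the other Leibniz term
  -- survives.
  have hXf : X ⟨V', hV'U⟩ (𝒪.res hV' f) = ∑ a, C a * X ⟨V', hV'U⟩ (G a) := by
    rw [hfres, map_add, map_sum, show X ⟨V', hV'U⟩ (algebraMap ℂ _ (h y.1)) = 0 from
      (hX.ker hV'U).algebraMap_mem _, zero_add]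
    refine Finset.sum_congr rfl fun a _ => ?_
    rw [hX.leibniz hV'U _ (hCeven a), hCker, zero_mul, zero_add, sgn_zero_right, one_smul]
  have e := χ.isoOn_res hV' (hV.trans hU) (X ⟨V, hV⟩ f) ⟨y.1, hy⟩
  rw [hX.res hV' hV, hXf, map_sum] at e
  -- At the point `y` every factor `x_a - y_a` is zero.
  refine e.symm.trans ?_
  simp [hCiso, Model.coord]

theorem eq_zero_of_isDer : X = 0 := by
  funext ⟨V, hV⟩
  ext f
  change X ⟨V, hV⟩ f = 0
  obtain ⟨g, rfl⟩ := (χ.isoOn (hV.trans hU)).symm.surjective f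
  induction g using Model.induction with
  | pure h hh l =>
    have := mul_mem (holomorphic_mem_ker hX hU hc hV hh) (grassmann_mem_ker hX hU hc hV l)
    rw [← map_mul, Model.pure_mul_pure] at this
    have e : Model.pure (h * fun _ => 1) (hh.mul (differentiableOn_const 1)) (1 * l) =
        Model.pure (W := χ.dom V) h hh l := by
      apply Subtype.ext; funext x
      simp [Model.pure]
    rw [e] at this
    exact this
  | add f g hf hg => rw [map_add, map_add, hf, hg, add_zero]

end Unique

/-- A vector field is determined by its values on coordinates. -/
theorem vf_eq_zero {V : Opens M} (hV : V ≤ χ.source) {X : 𝒪.VF V}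
    (hX : ∀ a, X.app (𝒪.res hV (χ.coord a)) = 0) : X = 0 := by
  obtain ⟨X0, X1, rfl⟩ := X.exists_homogeneous_add
  -- Coordinates are homogeneous, so the even and odd parts of `X` take values of different parities
  -- on them and must vanish separately.
  have hp := fun a => 𝒪.res_parity hV (χ.coord_mem_parity a)
  have h := fun a => SuperSheaf.eq_zero_of_add_eq_zero
    ((add_left_injective _).ne zero_ne_one)
    (SuperSheaf.IsDer.parity X0.2 le_rfl (hp a)) (SuperSheaf.IsDer.parity X1.2 le_rfl (hp a)) (hX a)
  have h0 := eq_zero_of_isDer X0.2 hV fun a => (h a).1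
  have h1 := eq_zero_of_isDer X1.2 hV fun a => (h a).2
  apply Subtype.ext
  change X0.1 + X1.1 = 0
  rw [h0, h1, add_zero]

theorem existsUnique_vf {V : Opens M} (hV : V ≤ χ.source) (s : Fin p ⊕ Fin q → 𝒪.Sec V) :
    ∃! X : 𝒪.VF V, ∀ a, X.app (𝒪.res hV (χ.coord a)) = s a := by
  choose E hE using χ.exists_coordVF
  -- The combination `Σ s_a ∂_a`; with coefficients on the left no Koszul sign appears.
  refine ⟨∑ a, s a • SuperSheaf.VF.res hV (E a), fun c => ?_, fun X hX => ?_⟩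
  · rw [SuperSheaf.VF.sum_app]
    simp only [SuperSheaf.VF.smul_app, ← SuperSheaf.VF.res_app, hE]
    rw [Finset.sum_eq_single c]
    · simp
    · intro a _ hac; simp [hac]
    · simp
  · rw [← sub_eq_zero]
    refine χ.vf_eq_zero hV fun c => ?_
    rw [sub_eq_add_neg, SuperSheaf.VF.add_app, hX c, ← neg_one_smul (𝒪.Sec V),
      SuperSheaf.VF.smul_app, SuperSheaf.VF.sum_app]
    simp only [SuperSheaf.VF.smul_app, ← SuperSheaf.VF.res_app, hE]
    rw [Finset.sum_eq_single c]
    · simp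
    · intro a _ hac; simp [hac]
    · simp

end SuperChart

/-! ### Gluing -/

variable {𝒪 : SuperSheaf.{u, v} N M}

namespace SuperModule

variable {F : SuperModule.{u, v, w} 𝒪}

theorem IsSheaf.glue (hF : F.IsSheaf) {U : Opens M} {ι : Type u} {V : ι → Opens M}
    (hV : ∀ i, V i ≤ U) (hU : ∀ x ∈ U, ∃ i, x ∈ V i) (s : ∀ i, F.Sec (V i))
    (hs : ∀ i j, F.res (inf_le_left : V i ⊓ V j ≤ V i) (s i) = F.res inf_le_right (s j)) :
    ∃! t : F.Sec U, ∀ i, F.res (hV i) t = s i := by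
  obtain rfl : U = ⨆ i, V i := le_antisymm
    (fun x hx => Opens.mem_iSup.2 (hU x hx)) (iSup_le hV)
  exact hF V s hs

theorem IsSheaf.eq_of_locally_eq (hF : F.IsSheaf) {U : Opens M} {s t : F.Sec U}
    (h : ∀ x ∈ U, ∃ (V : Opens M) (hV : V ≤ U), x ∈ V ∧ F.res hV s = F.res hV t) : s = t := by
  choose V hV hx e using fun x : U => h x.1 x.2
  refine (hF.glue hV (fun x hx' => ⟨⟨x, hx'⟩, hx _⟩) (fun x => F.res (hV x) s) ?_).unique
    (fun _ => rfl) (fun x => (e x).symm)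
  intro x y
  rw [F.res_res, F.res_res]

end SuperModule

namespace SuperSheaf

theorem glue {U : Opens M} {ι : Type u} {V : ι → Opens M}
    (hV : ∀ i, V i ≤ U) (hU : ∀ x ∈ U, ∃ i, x ∈ V i) (s : ∀ i, 𝒪.Sec (V i))
    (hs : ∀ i j, 𝒪.res (inf_le_left : V i ⊓ V j ≤ V i) (s i) = 𝒪.res inf_le_right (s j)) :
    ∃! t : 𝒪.Sec U, ∀ i, 𝒪.res (hV i) t = s i := by
  obtain rfl : U = ⨆ i, V i := le_antisymm
    (fun x hx => Opens.mem_iSup.2 (hU x hx)) (iSup_le hV)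
  exact 𝒪.gluing V s hs

theorem eq_of_res_eq {U : Opens M} {ι : Type u} {V : ι → Opens M}
    (hV : ∀ i, V i ≤ U) (hU : ∀ x ∈ U, ∃ i, x ∈ V i) {s t : 𝒪.Sec U}
    (h : ∀ i, 𝒪.res (hV i) s = 𝒪.res (hV i) t) : s = t :=
  (glue hV hU (fun i => 𝒪.res (hV i) s) (fun i j => by rw [𝒪.res_res, 𝒪.res_res])).unique
    (fun _ => rfl) (fun i => (h i).symm)

theorem mem_parity_of_res_mem {U : Opens M} {ι : Type u} {V : ι → Opens M}
    (hV : ∀ i, V i ≤ U) (hU : ∀ x ∈ U, ∃ i, x ∈ V i) {k : ZMod 2} {s : 𝒪.Sec U}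
    (h : ∀ i, 𝒪.res (hV i) s ∈ 𝒪.parity (V i) k) : s ∈ 𝒪.parity U k := by
  obtain ⟨f0, h0, f1, h1, rfl⟩ := exists_parity_add s
  fin_cases k
  · have : f1 = 0 := eq_of_res_eq hV hU fun i => by
      rw [map_zero]
      refine eq_zero_of_mem_parity zero_ne_one ?_ (𝒪.res_parity (hV i) h1)
      have := sub_mem (h i) (𝒪.res_parity (hV i) h0)
      rwa [map_add, add_sub_cancel_left] at this
    rw [this, add_zero]; exact h0
  · have : f0 = 0 := eq_of_res_eq hV hU fun i => by
      rw [map_zero]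
      refine eq_zero_of_mem_parity zero_ne_one (𝒪.res_parity (hV i) h0) ?_
      have := sub_mem (h i) (𝒪.res_parity (hV i) h1)
      rwa [map_add, add_sub_cancel_right] at this
    rw [this, zero_add]; exact h1

theorem VF.eq_of_res_eq {U : Opens M} {ι : Type u} {V : ι → Opens M}
    (hV : ∀ i, V i ≤ U) (hU : ∀ x ∈ U, ∃ i, x ∈ V i) {X Y : 𝒪.VF U}
    (h : ∀ i, VF.res (hV i) X = VF.res (hV i) Y) : X = Y := by
  apply Subtype.ext; funext ⟨W, hW⟩; ext f
  refine SuperSheaf.eq_of_res_eq (V := fun i => W ⊓ V i) (fun i => inf_le_left)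
    (fun x hx => ?_) fun i => ?_
  · obtain ⟨i, hi⟩ := hU x (hW hx)
    exact ⟨i, hx, hi⟩
  · rw [X.apply_res hW, Y.apply_res hW]
    exact LinearMap.congr_fun (congrFun (congrArg Subtype.val (h i)) ⟨W ⊓ V i, inf_le_right⟩) _

/-- The value on `f` over `W` is glued from the values `X_i (f|_{W ∩ V_i})`. Linearity and the
axioms of a derivation are then checked after restriction to each `W ∩ V_i`. -/
theorem HVF.glue {U : Opens M} {ι : Type u} {V : ι → Opens M} {k : ZMod 2}
    (hV : ∀ i, V i ≤ U) (hU : ∀ x ∈ U, ∃ i, x ∈ V i) (X : ∀ i, 𝒪.HVF k (V i))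
    (hX : ∀ i j (W : Opens M) (hi : W ≤ V i) (hj : W ≤ V j), (X i).1 ⟨W, hi⟩ = (X j).1 ⟨W, hj⟩) :
    ∃ Y : 𝒪.HVF k U, ∀ i (W : Opens M) (hi : W ≤ V i),
      Y.1 ⟨W, hi.trans (hV i)⟩ = (X i).1 ⟨W, hi⟩ := by
  have hder := fun i => ((X i).2 : 𝒪.IsDer k (X i).1)
  have hcover : ∀ {W : Opens M}, W ≤ U → ∀ x ∈ W, ∃ i, x ∈ W ⊓ V i := fun hW x hx => by
    obtain ⟨i, hi⟩ := hU x (hW hx)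
    exact ⟨i, hx, hi⟩
  have hex : ∀ (W : Opens M) (_ : W ≤ U) (f : 𝒪.Sec W), ∃ g : 𝒪.Sec W, ∀ i,
      𝒪.res (inf_le_left : W ⊓ V i ≤ W) g =
        (X i).1 ⟨W ⊓ V i, inf_le_right⟩ (𝒪.res inf_le_left f) := fun W hW f =>
    (SuperSheaf.glue (V := fun i => W ⊓ V i) (fun i => inf_le_left) (hcover hW)
      (fun i => (X i).1 ⟨W ⊓ V i, inf_le_right⟩ (𝒪.res inf_le_left f)) (fun i j => by
        rw [(hder i).res _ inf_le_right, (hder j).res _ inf_le_right, 𝒪.res_res, 𝒪.res_res,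
          hX i j])).exists
  choose op hop using hex
  have sep : ∀ {W : Opens M} (_ : W ≤ U) {f g : 𝒪.Sec W},
      (∀ i, 𝒪.res (inf_le_left : W ⊓ V i ≤ W) f = 𝒪.res inf_le_left g) → f = g := fun hW _ _ h =>
    SuperSheaf.eq_of_res_eq (V := fun i => _ ⊓ V i) (fun i => inf_le_left) (hcover hW) h
  refine ⟨⟨fun W => ⟨⟨op W.1 W.2, fun f g => ?_⟩, fun c f => ?_⟩, ⟨?_, ?_, ?_, ?_⟩⟩, ?_⟩
  · refine sep W.2 fun i => ?_
    rw [map_add, hop, hop, hop, map_add, map_add]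
  · refine sep W.2 fun i => ?_
    rw [map_smul, hop, hop, map_smul, map_smul]; rfl
  · intro W' W h hW f
    refine sep (h.trans hW) fun i => ?_
    change 𝒪.res _ (𝒪.res h (op W hW f)) = 𝒪.res _ (op W' _ (𝒪.res h f))
    rw [hop, 𝒪.res_res, 𝒪.res_res, ← 𝒪.res_res (inf_le_inf_right (V i) h) inf_le_left, hop,
      (hder i).res _ inf_le_right, 𝒪.res_res]
  · intro W hW j f hf
    refine mem_parity_of_res_mem (V := fun i => W ⊓ V i) (fun i => inf_le_left) (hcover hW)
      fun i => ?_
    change 𝒪.res _ (op W hW f) ∈ _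
    rw [hop]
    exact (hder i).parity inf_le_right (𝒪.res_parity _ hf)
  · intro W hW l
    refine sep hW fun i => ?_
    change 𝒪.res _ (op W hW _) = _
    rw [hop, 𝒪.res_const, (hder i).const, map_zero]
  · intro W hW j f g hf
    refine sep hW fun i => ?_
    change 𝒪.res _ (op W hW (f * g)) =
      𝒪.res _ (op W hW f * g + sgn k j • (f * op W hW g))
    rw [hop, map_mul, (hder i).leibniz _ _ (𝒪.res_parity _ hf), map_add, map_zsmul, map_mul,
      map_mul, hop, hop]
  · intro i W hi
    ext f
    refine sep (hi.trans (hV i)) fun j => ?_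
    change 𝒪.res _ (op W _ f) = _
    rw [hop, (hder i).res _ hi, hX j i]

/-- A section of the tangent sheaf is by definition a sum of an even and an odd derivation over all
of `U`, so the two parts are glued separately. They are compatible on overlaps because the parity
decomposition is direct. -/
theorem VF.glue {U : Opens M} {ι : Type u} {V : ι → Opens M}
    (hV : ∀ i, V i ≤ U) (hU : ∀ x ∈ U, ∃ i, x ∈ V i) (X : ∀ i, 𝒪.VF (V i))
    (hX : ∀ i j, VF.res (inf_le_left : V i ⊓ V j ≤ V i) (X i) = VF.res inf_le_right (X j)) :
    ∃ Y : 𝒪.VF U, ∀ i, VF.res (hV i) Y = X i := by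
  choose X0 X1 hsum using fun i => (X i).exists_homogeneous_add
  have hcomp : ∀ i j,
      VF.res (inf_le_left : V i ⊓ V j ≤ V i) (X0 i).toVF = VF.res inf_le_right (X0 j).toVF ∧
      VF.res (inf_le_left : V i ⊓ V j ≤ V i) (X1 i).toVF = VF.res inf_le_right (X1 j).toVF := by
    intro i j
    have h := hX i j
    rw [hsum, hsum, map_add, map_add] at h
    have d := AddSubgroup.disjoint_def.1 ((tangent 𝒪).isCompl_parity (V i ⊓ V j)).disjoint
      (x := VF.res (inf_le_left : V i ⊓ V j ≤ V i) (X0 i).toVF - VF.res inf_le_right (X0 j).toVF)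
      (sub_mem ((tangent 𝒪).res_parity inf_le_left (X0 i).2)
        ((tangent 𝒪).res_parity inf_le_right (X0 j).2))
    have h' : VF.res (inf_le_left : V i ⊓ V j ≤ V i) (X0 i).toVF -
        VF.res inf_le_right (X0 j).toVF =
        VF.res inf_le_right (X1 j).toVF -
          VF.res (inf_le_left : V i ⊓ V j ≤ V i) (X1 i).toVF := by
      rw [sub_eq_sub_iff_add_eq_add, h, add_comm]
    have z := d (by
      rw [h']
      exact sub_mem ((tangent 𝒪).res_parity inf_le_right (X1 j).2)
        ((tangent 𝒪).res_parity inf_le_left (X1 i).2))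
    rw [z] at h'
    exact ⟨sub_eq_zero.1 z, (sub_eq_zero.1 h'.symm).symm⟩
  obtain ⟨Y0, hY0⟩ := HVF.glue hV hU X0 fun i j W hi hj =>
    congrFun (congrArg Subtype.val (hcomp i j).1) ⟨W, le_inf hi hj⟩
  obtain ⟨Y1, hY1⟩ := HVF.glue hV hU X1 fun i j W hi hj =>
    congrFun (congrArg Subtype.val (hcomp i j).2) ⟨W, le_inf hi hj⟩
  refine ⟨Y0.toVF + Y1.toVF, fun i => ?_⟩
  rw [hsum]
  apply Subtype.ext; funext ⟨W, hW⟩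
  exact congrArg₂ (· + ·) (hY0 i W hW) (hY1 i W hW)

end SuperSheaf

/-! ### The isomorphism defined by a primitive section -/

section Primitive

variable {F : SuperModule.{u, v, w} 𝒪} {D : Connection F} {A : EndForm F} {u : F.Sec ⊤}

/-- The term carrying the Koszul sign contains `∇s = 0`, so the formula extends to inhomogeneous `X`
and `f`. -/
theorem Connection.cov_smul_of_flat (D : Connection F) {U : Opens M} {s : F.Sec U}
    (hs : ∀ X : 𝒪.VF U, D.cov X s = 0) (X : 𝒪.VF U) (f : 𝒪.Sec U) :
    D.cov X (f • s) = X.app f • s := by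
  have key : ∀ {i : ZMod 2} (X : 𝒪.HVF i U), D.cov X.toVF (f • s) = X.toVF.app f • s := by
    intro i X
    obtain ⟨f0, h0, f1, h1, rfl⟩ := SuperSheaf.exists_parity_add f
    rw [add_smul, D.add_right, D.leibniz X s h0, D.leibniz X s h1, hs]
    simp only [smul_zero, add_zero, ← add_smul]
    congr 1
    exact (map_add (X.1 ⟨U, le_rfl⟩) f0 f1).symm
  obtain ⟨X0, X1, rfl⟩ := X.exists_homogeneous_add
  rw [D.add_left, key, key, ← add_smul]; rfl

theorem SuperModule.res_sum (F : SuperModule.{u, v, w} 𝒪) {V U : Opens M} (h : V ≤ U)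
    {ι : Type*} (t : Finset ι) (c : ι → 𝒪.Sec U) (s : ι → F.Sec U) :
    F.res h (∑ a ∈ t, c a • s a) = ∑ a ∈ t, 𝒪.res h (c a) • F.res h (s a) := by
  rw [map_sum]
  exact Finset.sum_congr rfl fun a _ => F.res_smul h _ _

/-- `∇_X (B u) = i_X(A)(u)`, in components. -/
theorem PrimitiveData.val_eq_sum {U : Opens M} (P : PrimitiveData D A u U)
    (hu : D.IsFlatSection u) {V : Opens M} (h : V ≤ U) (X : 𝒪.VF V) :
    A.val X (F.res le_top u) = ∑ c, X.app (𝒪.res h (P.b c)) • F.res h (P.frame c) := by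
  have e := P.cov_B h X (F.res le_top u)
  have hB : P.B.map V h (F.res le_top u) =
      ∑ c, 𝒪.res h (P.b c) • F.res h (P.frame c) := by
    have := P.B.map_res h le_rfl (F.res le_top u)
    rw [F.res_res, P.B_apply, F.res_sum] at this
    exact this.symm
  rw [hu le_top X, map_zero, sub_zero, hB] at e
  rw [← e]
  refine (map_sum (AddMonoidHom.mk' (D.cov X) (D.add_right X)) _ _).trans ?_
  refine Finset.sum_congr rfl fun c _ => ?_
  exact D.cov_smul_of_flat (fun Y => P.flat c h Y) X _

/-- The morphism `X ↦ i_X(A)(u)` from the tangent sheaf to `F`. -/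
def EndForm.eval (A : EndForm F) (u : F.Sec ⊤) (U : Opens M) : 𝒪.VF U →ₗ[𝒪.Sec U] F.Sec U where
  toFun X := A.val X (F.res le_top u)
  map_add' X Y := A.add_left X Y _
  map_smul' f X := A.smul_left f X _

theorem EndForm.eval_apply (A : EndForm F) (u : F.Sec ⊤) {U : Opens M} (X : 𝒪.VF U) :
    A.eval u U X = A.val X (F.res le_top u) := rfl

theorem EndForm.res_eval (A : EndForm F) (u : F.Sec ⊤) {V U : Opens M} (h : V ≤ U)
    (X : 𝒪.VF U) : F.res h (A.eval u U X) = A.eval u V (SuperSheaf.VF.res h X) := by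
  rw [A.eval_apply, A.res, F.res_res, A.eval_apply]

theorem EndForm.eval_mem_parity (A : EndForm F) {u : F.Sec ⊤} (hu : u ∈ F.parity ⊤ 0)
    {U : Opens M} {i : ZMod 2} (X : 𝒪.HVF i U) : A.eval u U X.toVF ∈ F.parity U i := by
  have := A.parity X (F.res_parity (le_top : U ≤ ⊤) hu)
  rwa [add_zero] at this

/-- On a chart with coordinates `b^c`, the components of `A_X u` in the flat frame are the values
`X(b^c)`. These determine `X` and can be prescribed arbitrarily. -/
theorem IsPrimitive.exists_bijective_eval (hu : IsPrimitive D A u) (x : M) :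
    ∃ U : Opens M, x ∈ U ∧ ∀ V ≤ U, Function.Bijective (A.eval u V) := by
  obtain ⟨U, hxU, ⟨P⟩⟩ := hu.exists_data x
  obtain ⟨χ, hχU, hxχ, hχ⟩ := P.isLocalIso x hxU
  refine ⟨χ.source, hxχ, fun V hV => ?_⟩
  have hcoord : ∀ c, 𝒪.res (hV.trans hχU) (P.b c) = 𝒪.res hV (χ.coord c) := fun c => by
    rw [hχ, 𝒪.res_res]
  have heval : ∀ X : 𝒪.VF V, A.eval u V X =
      ∑ c, X.app (𝒪.res hV (χ.coord c)) • F.res (hV.trans hχU) (P.frame c) := fun X => by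
    rw [A.eval_apply, P.val_eq_sum hu.flat (hV.trans hχU)]
    simp only [hcoord]
  constructor
  · intro X Y h
    obtain ⟨c, _, huniq⟩ := P.isFrame.basis (hV.trans hχU) (A.eval u V Y)
    have hX := huniq _ (h.symm.trans (heval X))
    have hY := huniq _ (heval Y)
    exact (χ.existsUnique_vf hV c).unique (congrFun hX) (congrFun hY)
  · intro t
    obtain ⟨c, hc, _⟩ := P.isFrame.basis (hV.trans hχU) t
    obtain ⟨X, hX, _⟩ := χ.existsUnique_vf hV c
    refine ⟨X, ?_⟩
    rw [heval, hc]
    exact Finset.sum_congr rfl fun a _ => by rw [hX a]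

theorem IsPrimitive.bijective_eval (hF : F.IsSheaf) (hu : IsPrimitive D A u) (U : Opens M) :
    Function.Bijective (A.eval u U) := by
  choose O hO hbij using hu.exists_bijective_eval
  have hcov : ∀ x ∈ U, ∃ y : M, x ∈ U ⊓ O y := fun x hx => ⟨x, hx, hO x⟩
  constructor
  · intro X Y h
    refine SuperSheaf.VF.eq_of_res_eq (V := fun y => U ⊓ O y) (fun _ => inf_le_left) hcov
      fun y => ?_
    apply (hbij y _ inf_le_right).1
    rw [← A.res_eval, ← A.res_eval, h]
  · intro t
    choose X hX using fun y : M => (hbij y (U ⊓ O y) inf_le_right).2 (F.res inf_le_left t)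
    obtain ⟨Y, hY⟩ := SuperSheaf.VF.glue (V := fun y => U ⊓ O y) (fun _ => inf_le_left) hcov X
      (fun y z => (hbij y _ (inf_le_left.trans inf_le_right)).1 (by
        rw [← A.res_eval, ← A.res_eval, hX, hX, F.res_res, F.res_res]))
    refine ⟨Y, hF.eq_of_locally_eq fun x hx => ⟨U ⊓ O x, inf_le_left, ⟨hx, hO x⟩, ?_⟩⟩
    rw [A.res_eval, hY, hX]

/-- An isomorphism satisfies the characterization of `β^*` exactly if its inverse is
`X ↦ i_X(A)(u)`. -/
theorem isBetaStar_iff (hF : F.IsSheaf) (hu : IsPrimitive D A u) (β : ModIso F (tangent 𝒪)) :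
    IsBetaStar D A u β ↔ ∀ (U : Opens M) (s : F.Sec U), A.eval u U (β.equiv U s) = s := by
  constructor
  · intro hβ U s
    refine hF.eq_of_locally_eq fun x hx => ?_
    obtain ⟨U', hxU, ⟨P⟩⟩ := hu.exists_data x
    refine ⟨U ⊓ U', inf_le_left, ⟨hx, hxU⟩, ?_⟩
    -- By `𝒪`-linearity the claim need only be checked on a flat frame, where it is the condition
    -- `β(f_a) b^c = δ_a^c`.
    have hframe : ∀ a, A.eval u U' (β.equiv U' (P.frame a)) = P.frame a := fun a => by
      rw [A.eval_apply, P.val_eq_sum hu.flat le_rfl]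
      simp only [𝒪.res_self, F.res_self, hβ P]
      simp
    obtain ⟨c, hc, _⟩ := P.isFrame.basis (inf_le_right : U ⊓ U' ≤ U') (F.res inf_le_left s)
    have hres := β.equiv_res (inf_le_left : U ⊓ U' ≤ U) s
    change SuperSheaf.VF.res inf_le_left _ = _ at hres
    rw [A.res_eval, hres, hc, map_sum, map_sum]
    refine Finset.sum_congr rfl fun a _ => ?_
    have hres' := β.equiv_res (inf_le_right : U ⊓ U' ≤ U') (P.frame a)
    change SuperSheaf.VF.res inf_le_right _ = _ at hres'
    rw [map_smul, map_smul, ← hres', ← A.res_eval, hframe]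
  · intro h U P a c
    -- Two expansions of `f_a` in the frame, one with coefficients `β(f_a) b^c` and one with
    -- `δ_a^c`, must agree.
    obtain ⟨d, _, huniq⟩ := P.isFrame.basis le_rfl (P.frame a)
    have e1 := huniq _ ((h U (P.frame a)).symm.trans (P.val_eq_sum hu.flat le_rfl _))
    have e2 := huniq (fun c => if a = c then 1 else 0) (by simp [F.res_self])
    have := congrFun (e1.trans e2.symm) c
    rwa [𝒪.res_self] at this

theorem existsUnique_isBetaStar (hF : F.IsSheaf) (hu : IsPrimitive D A u) :
    ∃! β : ModIso F (tangent 𝒪), IsBetaStar D A u β := by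
  let α := fun U => LinearEquiv.ofBijective (A.eval u U) (hu.bijective_eval hF U)
  have hα : ∀ U (X : 𝒪.VF U), α U X = A.eval u U X := fun _ _ => rfl
  let β : ModIso F (tangent 𝒪) :=
    { equiv := fun U => (α U).symm
      equiv_res := fun {V U} h s => by
        rw [LinearEquiv.eq_symm_apply, hα]
        change A.eval u V (SuperSheaf.VF.res h _) = _
        rw [← A.res_eval, ← hα, LinearEquiv.apply_symm_apply]
      equiv_parity := fun {U i s} hs => by
        -- Evaluation at the even section `u` preserves parity; its inverse does too, since the
        -- component of the wrong parity maps to a section that is both even and odd.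
        obtain ⟨X0, X1, e⟩ := ((α U).symm s).exists_homogeneous_add
        have hs' : s = A.eval u U X0.toVF + A.eval u U X1.toVF := by
          rw [← map_add, ← e, ← hα, LinearEquiv.apply_symm_apply]
        have g0 := A.eval_mem_parity hu.even X0
        have g1 := A.eval_mem_parity hu.even X1
        have d : ∀ {x : F.Sec U}, x ∈ F.parity U 0 → x ∈ F.parity U 1 → x = 0 :=
          AddSubgroup.disjoint_def.1 (F.isCompl_parity U).disjoint
        rw [e]
        fin_cases i
        · have : A.eval u U X1.toVF = 0 := d (by
            have := sub_mem hs g0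
            rwa [hs', add_sub_cancel_left] at this) g1
          rw [← hα, LinearEquiv.map_eq_zero_iff] at this
          rw [this, add_zero]
          exact X0.2
        · have : A.eval u U X0.toVF = 0 := d g0 (by
            have := sub_mem hs g1
            rwa [hs', add_sub_cancel_right] at this)
          rw [← hα, LinearEquiv.map_eq_zero_iff] at this
          rw [this, zero_add]
          exact X1.2 }
  refine ⟨β, (isBetaStar_iff hF hu β).2 fun U s => (α U).apply_symm_apply s, fun β' h' => ?_⟩
  have h' := (isBetaStar_iff hF hu β').1 h'
  have : β'.equiv = β.equiv := by
    funext U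
    ext1 s
    exact (LinearEquiv.eq_symm_apply (α U)).2 (h' U s)
  obtain ⟨e, _, _⟩ := β'
  cases this
  rfl

end Primitive

/-! ### Pencils of flat connections -/

section Pencil

variable {F : SuperModule.{u, v, w} 𝒪} {D : Connection F} {A : EndForm F}

theorem sgn_mul_self (i j : ZMod 2) : sgn i j * sgn i j = 1 := by revert i j; decide

theorem sgn_add_right (i j k : ZMod 2) : sgn i (j + k) = sgn i j * sgn i k := by
  revert i j k; decide

/-- Needed to divide by `2` after comparing the curvatures at `λ = 1` and `λ = -1`. -/
theorem SuperModule.eq_zero_of_add_self_eq_zero {U : Opens M} {s : F.Sec U} (h : s + s = 0) : s = 0 := by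
  have e : scalar 𝒪 U (1 / 2) + scalar 𝒪 U (1 / 2) = 1 := by
    rw [scalar, ← map_add]; norm_num
  rw [← one_smul (𝒪.Sec U) s, ← e, add_smul, ← smul_add, h, smul_zero]

theorem EndForm.val_scalar_smul (A : EndForm F) {U : Opens M} (c : ℂ) (X : 𝒪.VF U) (s : F.Sec U) :
    A.val X (scalar 𝒪 U c • s) = scalar 𝒪 U c • A.val X s := by
  obtain ⟨X0, X1, rfl⟩ := X.exists_homogeneous_add
  rw [A.add_left, A.smul_right X0 s (scalar_mem U c), A.smul_right X1 s (scalar_mem U c),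
    A.add_left, smul_add, sgn_zero_right, sgn_zero_right, one_smul, one_smul]

/-- The operator `i_X(A)`. -/
def EndForm.op (A : EndForm F) {U : Opens M} (X : 𝒪.VF U) : AddMonoid.End (F.Sec U) :=
  AddMonoidHom.mk' (A.val X) (A.add_right X)

/-- The operator `∇_X`. -/
def Connection.op (D : Connection F) {U : Opens M} (X : 𝒪.VF U) : AddMonoid.End (F.Sec U) :=
  AddMonoidHom.mk' (D.cov X) (D.add_right X)

theorem EndForm.op_apply (A : EndForm F) {U : Opens M} (X : 𝒪.VF U) (s : F.Sec U) :
    A.op X s = A.val X s := rfl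

theorem EndForm.op_add (A : EndForm F) {U : Opens M} (X Y : 𝒪.VF U) :
    A.op (X + Y) = A.op X + A.op Y := by ext s; exact A.add_left X Y s

/-- `i_X(A)` as an additive function of `X`. -/
def EndForm.opHom (A : EndForm F) (U : Opens M) : 𝒪.VF U →+ AddMonoid.End (F.Sec U) :=
  AddMonoidHom.mk' A.op A.op_add

theorem EndForm.op_sub (A : EndForm F) {U : Opens M} (X Y : 𝒪.VF U) :
    A.op (X - Y) = A.op X - A.op Y := map_sub (A.opHom U) X Y

theorem EndForm.op_zsmul (A : EndForm F) {U : Opens M} (n : ℤ) (X : 𝒪.VF U) :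
    A.op (n • X) = n • A.op X := map_zsmul (A.opHom U) n X

theorem Connection.IsFlat.op_eq {D : Connection F} (h : D.IsFlat) {U : Opens M} {i j : ZMod 2}
    (X : 𝒪.HVF i U) (Y : 𝒪.HVF j U) :
    D.op X.toVF * D.op Y.toVF - sgn i j • (D.op Y.toVF * D.op X.toVF) =
      D.op (SuperSheaf.lie X Y).toVF := by
  ext s; exact h X Y s

theorem pencil_op_zero {U : Opens M} (X : 𝒪.VF U) : (D.pencil A 0).op X = D.op X := by
  ext s
  change D.cov X s + scalar 𝒪 U 0 • A.val X s = D.cov X s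
  simp [scalar]

theorem pencil_op_one {U : Opens M} (X : 𝒪.VF U) : (D.pencil A 1).op X = D.op X + A.op X := by
  ext s
  change D.cov X s + scalar 𝒪 U 1 • A.val X s = D.cov X s + A.val X s
  simp [scalar]

theorem pencil_op_neg_one {U : Opens M} (X : 𝒪.VF U) :
    (D.pencil A (-1)).op X = D.op X - A.op X := by
  ext s
  change D.cov X s + scalar 𝒪 U (-1) • A.val X s = D.cov X s - A.val X s
  simp [scalar, sub_eq_add_neg]

variable (hflat : ∀ c : ℂ, (D.pencil A c).IsFlat)

include hflat

/-- The coefficient of `λ²` in the curvature: the sum of the flatness equations at `λ = 1` and `λ =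
-1`, minus twice the one at `λ = 0`, is twice this relation. -/
theorem op_mul_comm {U : Opens M} {i j : ZMod 2} (X : 𝒪.HVF i U) (Y : 𝒪.HVF j U) :
    A.op X.toVF * A.op Y.toVF = sgn i j • (A.op Y.toVF * A.op X.toVF) := by
  have h0 := Connection.IsFlat.op_eq (hflat 0) X Y
  have h1 := Connection.IsFlat.op_eq (hflat 1) X Y
  have h2 := Connection.IsFlat.op_eq (hflat (-1)) X Y
  simp only [pencil_op_zero, pencil_op_one, pencil_op_neg_one, add_mul, mul_add, sub_mul,
    mul_sub] at h0 h1 h2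
  have e : (A.op X.toVF * A.op Y.toVF - sgn i j • (A.op Y.toVF * A.op X.toVF)) +
      (A.op X.toVF * A.op Y.toVF - sgn i j • (A.op Y.toVF * A.op X.toVF)) = 0 := by
    rw [← h0] at h1 h2
    linear_combination (norm := module) h1 + h2
  rw [← sub_eq_zero]
  ext s
  exact SuperModule.eq_zero_of_add_self_eq_zero (DFunLike.congr_fun e s)

/-- The coefficient of `λ` in the curvature, in other words `∇A = 0` for the flat connection `∇`. -/
theorem op_lie {U : Opens M} {i j : ZMod 2} (X : 𝒪.HVF i U) (Y : 𝒪.HVF j U) :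
    A.op (SuperSheaf.lie X Y).toVF = D.op X.toVF * A.op Y.toVF + A.op X.toVF * D.op Y.toVF -
      sgn i j • (D.op Y.toVF * A.op X.toVF + A.op Y.toVF * D.op X.toVF) := by
  have h0 := Connection.IsFlat.op_eq (hflat 0) X Y
  have h1 := Connection.IsFlat.op_eq (hflat 1) X Y
  have h2 := op_mul_comm hflat X Y
  simp only [pencil_op_zero, pencil_op_one, add_mul, mul_add] at h0 h1
  rw [← h0, h2] at h1
  linear_combination (norm := module) -h1

variable {u : F.Sec ⊤} {β : ModIso F (tangent 𝒪)}
  (hβ : ∀ (U : Opens M) (s : F.Sec U), A.eval u U (β.equiv U s) = s)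

omit hflat in
include hβ in
theorem symm_eq_eval {U : Opens M} (X : 𝒪.VF U) : (β.equiv U).symm X = A.eval u U X := by
  conv_rhs => rw [← (β.equiv U).apply_symm_apply X]
  exact (hβ U _).symm

-- Evaluation of `A_X` at `u` recovers `X`, so identities between vector fields reduce to identities
-- between operators on `F`.
omit hflat in
include hβ in
theorem vf_eq_of_op_eq {U : Opens M} {X Y : 𝒪.VF U} (h : A.op X = A.op Y) : X = Y := by
  apply (β.equiv U).symm.injective
  rw [symm_eq_eval hβ, symm_eq_eval hβ]
  exact DFunLike.congr_fun h (F.res le_top u)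

include hβ

/-- `i_{X ∘ Y}(A) = i_X(A) i_Y(A)`. -/
theorem op_mul {U : Opens M} (X Y : 𝒪.VF U) :
    A.op ((A.transport β).val X Y) = A.op X * A.op Y := by
  have key : ∀ {i j : ZMod 2} (X : 𝒪.HVF i U) (Y : 𝒪.HVF j U),
      A.op ((A.transport β).val X.toVF Y.toVF) = A.op X.toVF * A.op Y.toVF := by
    intro i j X Y
    set P := (A.transport β).mul X Y with hP
    change A.op P.toVF = _
    have hPu : A.op P.toVF (F.res le_top u) = A.op X.toVF (A.op Y.toVF (F.res le_top u)) := by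
      refine (hβ U _).trans ?_
      rw [symm_eq_eval hβ]; rfl
    -- Both operators supercommute with `A_Z` with the same sign and agree on `u`, hence agree on
    -- `A_Z u`; such sections, for homogeneous `Z`, span `F`.
    have hom : ∀ {k : ZMod 2} (Z : 𝒪.HVF k U),
        A.op P.toVF (A.op Z.toVF (F.res le_top u)) =
          (A.op X.toVF * A.op Y.toVF) (A.op Z.toVF (F.res le_top u)) := by
      intro k Z
      have e1 := DFunLike.congr_fun (op_mul_comm hflat P Z) (F.res le_top u)
      have e2 : A.op X.toVF * A.op Y.toVF * A.op Z.toVF =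
          sgn (i + j) k • (A.op Z.toVF * (A.op X.toVF * A.op Y.toVF)) := by
        rw [mul_assoc, op_mul_comm hflat Y Z, mul_smul_comm, ← mul_assoc,
          op_mul_comm hflat X Z, smul_mul_assoc, smul_smul, SuperSheaf.sgn_add, mul_comm (sgn j k),
          mul_assoc]
      have e3 := DFunLike.congr_fun e2 (F.res le_top u)
      refine e1.trans (Eq.trans ?_ e3.symm)
      change sgn (i + j) k • A.op Z.toVF (A.op P.toVF _) = _
      rw [hPu]; rfl
    ext s
    have hs : s = A.eval u U (β.equiv U s) := (hβ U s).symm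
    obtain ⟨Z0, Z1, hZ⟩ := (β.equiv U s).exists_homogeneous_add
    rw [hs, hZ, map_add, map_add, map_add]
    exact congrArg₂ (· + ·) (hom Z0) (hom Z1)
  obtain ⟨X0, X1, rfl⟩ := X.exists_homogeneous_add
  obtain ⟨Y0, Y1, rfl⟩ := Y.exists_homogeneous_add
  rw [EndForm.add_left, EndForm.add_right, EndForm.add_right]
  simp only [EndForm.op_add, key, add_mul, mul_add]
  abel

/-- `i_{P_X(Z, W)}(A)` is the supercommutator of `i_X(A)` with an operator that does not depend
on `X`. -/
theorem op_poissonDefect {U : Opens M} {i k l : ZMod 2} (X : 𝒪.HVF i U) (Z : 𝒪.HVF k U)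
    (W : 𝒪.HVF l U) :
    A.op ((A.transport β).poissonDefect X Z W) =
      A.op X.toVF * (D.op ((A.transport β).mul Z W).toVF - D.op Z.toVF * A.op W.toVF -
          A.op Z.toVF * D.op W.toVF) -
        sgn i (k + l) • ((D.op ((A.transport β).mul Z W).toVF - D.op Z.toVF * A.op W.toVF -
          A.op Z.toVF * D.op W.toVF) * A.op X.toVF) := by
  have hZW : A.op ((A.transport β).mul Z W).toVF = A.op Z.toVF * A.op W.toVF :=
    op_mul hflat hβ Z.toVF W.toVF
  have hXW := op_mul_comm hflat X W
  have hXZ := op_mul_comm hflat X Z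
  rw [EndForm.poissonDefect, EndForm.op_sub, EndForm.op_sub, EndForm.op_zsmul, op_mul hflat hβ,
    op_mul hflat hβ, op_lie hflat, op_lie hflat, op_lie hflat, hZW, sgn_add_right]
  generalize D.op ((A.transport β).mul Z W).toVF = dZW
  generalize A.op X.toVF = aX at *
  generalize A.op Z.toVF = aZ at *
  generalize A.op W.toVF = aW at *
  generalize D.op X.toVF = dX
  generalize D.op Z.toVF = dZ
  generalize D.op W.toVF = dW
  -- After expansion all terms containing `∇_X` cancel; only these two products remain to be
  -- reordered.
  have e1 : aX * (aZ * dW) = sgn i k • (aZ * (aX * dW)) := by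
    rw [← mul_assoc, hXZ, smul_mul_assoc, mul_assoc]
  have e2 : dZ * (aX * aW) = sgn i l • (dZ * (aW * aX)) := by rw [hXW, mul_smul_comm]
  simp only [add_mul, mul_add, sub_mul, mul_sub, smul_mul_assoc, mul_smul_comm, mul_assoc, e1, e2]
  module

-- Homogeneity of `P_X(Z, W)` allows `op_mul_comm` to be applied to it.
omit hflat hβ in
theorem poissonDefect_mem (A : EndForm (tangent 𝒪)) {U : Opens M} {i k l : ZMod 2}
    (X : 𝒪.HVF i U) (Z : 𝒪.HVF k U) (W : 𝒪.HVF l U) :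
    (A.poissonDefect X Z W).1 ∈ 𝒪.der (i + (k + l)) U := by
  refine sub_mem (sub_mem (SuperSheaf.lie X (A.mul Z W)).2 ?_) (zsmul_mem ?_ _)
  · rw [← add_assoc]
    exact (A.mul (SuperSheaf.lie X Z) W).2
  · rw [add_left_comm]
    exact (A.mul Z (SuperSheaf.lie X W)).2

theorem isFManifold_transport : (A.transport β).IsFManifold where
  supercomm X Y := by
    apply vf_eq_of_op_eq hβ
    rw [EndForm.op_zsmul, op_mul hflat hβ, op_mul hflat hβ, op_mul_comm hflat]
  assoc X Y Z := by
    apply vf_eq_of_op_eq hβ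
    simp only [op_mul hflat hβ, mul_assoc]
  hertlingManin {U i j k l} X Y Z W := by
    apply vf_eq_of_op_eq hβ
    -- The Leibniz rule for the supercommutator of `A_X A_Y` with `E` leaves `A_{P_X(Z,W)}` to the
    -- left of `A_Y`; this relation matches it with `Y ∘ P_X(Z, W)`.
    have hcomm := op_mul_comm hflat Y (⟨_, poissonDefect_mem (A.transport β) X Z W⟩ :
      𝒪.HVF (i + (k + l)) U)
    change A.op Y.toVF * A.op ((A.transport β).poissonDefect X Z W) =
      sgn j (i + (k + l)) • (A.op ((A.transport β).poissonDefect X Z W) * A.op Y.toVF) at hcomm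
    have hXY : A.op ((A.transport β).mul X Y).toVF = A.op X.toVF * A.op Y.toVF :=
      op_mul hflat hβ X.toVF Y.toVF
    have hsgn : sgn i j * sgn j (i + (k + l)) = sgn j (k + l) := by
      rw [sgn_add_right, SuperSheaf.sgn_comm i j, ← mul_assoc, sgn_mul_self, one_mul]
    rw [EndForm.op_add, EndForm.op_zsmul, op_mul hflat hβ, op_mul hflat hβ, hcomm, smul_smul, hsgn,
      op_poissonDefect hflat hβ, op_poissonDefect hflat hβ, op_poissonDefect hflat hβ, hXY,
      SuperSheaf.sgn_add]
    generalize D.op ((A.transport β).mul Z W).toVF - D.op Z.toVF * A.op W.toVF -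
      A.op Z.toVF * D.op W.toVF = E
    simp only [mul_sub, sub_mul, smul_mul_assoc, mul_smul_comm, mul_assoc]
    module

/-- As `β⁻¹ X = A_X u`, this is `op_lie` applied to `u`, where `∇u = 0` removes two terms. The
contribution of `c A` to the torsion vanishes because the `A_X` supercommute. -/
theorem isTorsionFree_transport (hu : D.IsFlatSection u) (c : ℂ) :
    ((D.pencil A c).transport β).IsTorsionFree := by
  intro U i j X Y
  apply (β.equiv U).symm.injective
  have e1 := DFunLike.congr_fun (op_lie hflat X Y) (F.res le_top u)
  have e2 := DFunLike.congr_fun (op_mul_comm hflat X Y) (F.res le_top u)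
  change A.val _ _ = D.cov X.toVF (A.val Y.toVF _) + A.val X.toVF (D.cov Y.toVF _) -
    sgn i j • (D.cov Y.toVF (A.val X.toVF _) + A.val Y.toVF (D.cov X.toVF _)) at e1
  rw [hu le_top, hu le_top, show A.val X.toVF (0 : F.Sec U) = 0 from map_zero (A.op X.toVF),
    show A.val Y.toVF (0 : F.Sec U) = 0 from map_zero (A.op Y.toVF), add_zero, add_zero] at e1
  change A.val X.toVF (A.val Y.toVF _) = sgn i j • A.val Y.toVF (A.val X.toVF _) at e2
  change (β.equiv U).symm (β.equiv U ((D.pencil A c).cov X.toVF ((β.equiv U).symm Y.toVF)) -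
    sgn i j • β.equiv U ((D.pencil A c).cov Y.toVF ((β.equiv U).symm X.toVF))) = _
  rw [map_sub, map_zsmul, LinearEquiv.symm_apply_apply, LinearEquiv.symm_apply_apply,
    symm_eq_eval hβ, symm_eq_eval hβ, symm_eq_eval hβ, A.eval_apply, A.eval_apply, A.eval_apply,
    e1]
  change D.cov X.toVF _ + scalar 𝒪 U c • A.val X.toVF _ -
    sgn i j • (D.cov Y.toVF _ + scalar 𝒪 U c • A.val Y.toVF _) = _
  rw [e2, smul_add, smul_comm (sgn i j) (scalar 𝒪 U c)]
  abel

/-- For `e = β u` one has `A_e u = u`, so `A_{X∘e} u = A_X A_e u = A_X u` and `X ∘ e = X`. The other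
side follows by supercommutativity, without sign because `e` is even. -/
theorem isIdentity_transport (hu : u ∈ F.parity ⊤ 0) :
    (A.transport β).IsIdentity (β.equiv ⊤ u) := by
  intro U X
  set e : 𝒪.HVF 0 U := ⟨_, (tangent 𝒪).res_parity (le_top : U ≤ ⊤) (β.equiv_parity hu)⟩ with he
  have heV : e.toVF = SuperSheaf.VF.res le_top (β.equiv ⊤ u) := rfl
  have heu : A.op e.toVF (F.res le_top u) = F.res le_top u := by
    have h1 : e.toVF = β.equiv U (F.res le_top u) := β.equiv_res le_top u
    rw [h1]
    exact hβ U _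
  have hright : ∀ X : 𝒪.VF U, (A.transport β).val X e.toVF = X := by
    intro X
    apply (β.equiv U).symm.injective
    rw [symm_eq_eval hβ, symm_eq_eval hβ, A.eval_apply, A.eval_apply, ← A.op_apply,
      op_mul hflat hβ]
    exact congrArg (A.op X) heu
  rw [← heV]
  refine ⟨?_, hright X⟩
  obtain ⟨X0, X1, rfl⟩ := X.exists_homogeneous_add
  have hF := isFManifold_transport hflat hβ
  rw [EndForm.add_right, hF.supercomm e X0, hF.supercomm e X1, hright, hright, sgn_zero_left,
    sgn_zero_left, one_smul, one_smul]

omit hflat hβ in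
theorem isFlat_transport {D : Connection F} (hD : D.IsFlat) (β : ModIso F (tangent 𝒪)) :
    (D.transport β).IsFlat := by
  intro U i j X Y s
  have h := congrArg (β.equiv U) (hD X Y ((β.equiv U).symm s))
  rw [map_sub, map_zsmul] at h
  simpa [Connection.transport] using h

end Pencil

/-! ### Rescaling the direction of the pencil -/

section Scale

variable {F : SuperModule.{u, v, w} 𝒪}

theorem pencil_scale (D : Connection F) (A : EndForm F) (c d : ℂ) :
    D.pencil (A.scale c) d = D.pencil A (d * c) := by
  simp only [Connection.pencil, Connection.addForm, EndForm.scale, smul_smul, scalar, map_mul]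

theorem transport_scale (A : EndForm F) (β : ModIso F (tangent 𝒪)) (c : ℂ) :
    (A.scale c).transport β = (A.transport β).scale c := by
  simp only [EndForm.transport, EndForm.scale, map_smul]

/-- The pair `(cA, c⁻¹u)` defines the same evaluation map as `(A, u)`, hence the same `β`. This
reduces the multiplication with factor `c` to the case `c = 1`. -/
theorem eval_scale (A : EndForm F) {c : ℂ} (hc : c ≠ 0) (u : F.Sec ⊤) (U : Opens M) :
    (A.scale c).eval (scalar 𝒪 ⊤ c⁻¹ • u) U = A.eval u U := by
  ext X
  change scalar 𝒪 U c • A.val X (F.res le_top (scalar 𝒪 ⊤ c⁻¹ • u)) = A.val X (F.res le_top u)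
  have : 𝒪.res (le_top : U ≤ ⊤) (scalar 𝒪 ⊤ c⁻¹) = scalar 𝒪 U c⁻¹ := AlgHom.commutes _ _
  rw [F.res_smul, this, A.val_scalar_smul, smul_smul, scalar, scalar, ← map_mul,
    mul_inv_cancel₀ hc, map_one, one_smul]

end Scale

end SuperGeom

/-! ### The theorem -/

open SuperGeom in
theorem theorem4p3 {N : ℕ} {M : Type u} [TopologicalSpace M] (𝒪 : SuperSheaf.{u, v} N M)
    (p q : ℕ) (hM : 𝒪.IsSupermanifold p q)
    (F : SuperModule.{u, v, w} 𝒪) (hF : F.IsLocallyFree)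
    (D : Connection F) (A : EndForm F) (hflat : ∀ c : ℂ, (D.pencil A c).IsFlat)
    (u : F.Sec ⊤) (hu : IsPrimitive D A u) :
    (∃! β : ModIso F (tangent 𝒪), IsBetaStar D A u β) ∧
    ∀ β : ModIso F (tangent 𝒪), IsBetaStar D A u β →
      (∀ c : ℂ, ((D.pencil A c).transport β).IsTorsionFree ∧
        ((D.pencil A c).transport β).IsFlat) ∧
      (∀ c : ℂ, c ≠ 0 → ((A.transport β).scale c).IsFManifold) ∧
      ∃ c : ℂ, c ≠ 0 ∧ ((A.transport β).scale c).IsIdentity (β.equiv ⊤ u) := by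
  refine ⟨existsUnique_isBetaStar hF.isSheaf hu, fun β hβ => ?_⟩
  have hβ := (isBetaStar_iff hF.isSheaf hu β).1 hβ
  have hscale : ∀ c d : ℂ, (D.pencil (A.scale c) d).IsFlat := fun c d => by
    rw [pencil_scale]; exact hflat _
  have hβc : ∀ c : ℂ, c ≠ 0 → ∀ (U : Opens M) (s : F.Sec U),
      (A.scale c).eval (scalar 𝒪 ⊤ c⁻¹ • u) U (β.equiv U s) = s := fun c hc U s => by
    rw [eval_scale A hc]; exact hβ U s
  -- The multiplication with identity `β u` is the one with `c = 1`, because `A_{β u} u = u` holds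
  -- for `A` itself.
  refine ⟨fun c => ⟨isTorsionFree_transport hflat hβ hu.flat c, isFlat_transport (hflat c) β⟩,
    fun c hc => ?_, 1, one_ne_zero, ?_⟩
  · rw [← transport_scale]
    exact isFManifold_transport (hscale c) (hβc c hc)
  · rw [← transport_scale]
    have hβ1 : ∀ (U : Opens M) (s : F.Sec U), (A.scale 1).eval u U (β.equiv U s) = s := by
      simpa [scalar] using hβc 1 one_ne_zero
    intro U X
    exact isIdentity_transport (hscale 1) hβ1 hu.even X
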